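/- Let $F$ be a set of functions $\mathbb R\to\mathbb R$ (activation functions) with $\mathrm{id}\in F$, whose members are named by pairwise distinct finite binary words. An $F$-network $N$ is a layered feedforward network with $n\ge 0$ input nodes, finitely many (possibly zero) hidden layers and an output layer of $m\ge 0$ nodes. The $i$-th node of a non-input layer $\ell$ has an activation $\sigma_{\ell i}\in F$, a rational bias $b_{\ell i}$ and rational weights $c^{(\ell-1)}_{ji}$ from the nodes $j$ of layer $\ell-1$ (an absent edge has weight $0$), and it outputs $y_{\ell i}=\sigma_{\ell i}\bigl(\sum_j c^{(\ell-1)}_{ji}y_{(\ell-1)j}+b_{\ell i}\bigr)$; the values $y_{0j}=x_j$ are the inputs. Thus $N$ computes a function $\mathbb R^n\to\mathbb R^m$. For a set $Y$ of hidden nodes, $N\setminus Y$ is the network obtained by deleting the nodes in $Y$ and all edges at them, keeping all other activations, weights and biases (layers may become empty, and an empty sum is $0$). The set $Y$ is called necessary if $N\setminus Y$ does not compute the same function as $N$. Consider the following decision problems, whose instances are written as words over a finite alphabet, with rational numbers in binary: * $\mathrm{NE}(F)$: given two $F$-networks, do they compute the same function (in particular, with the same numbers of inputs and outputs)? * $\mathrm{ANECE}(F)$: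 given an $F$-network, is every non-empty set of its hidden nodes necessary? Then $\mathrm{NE}(F)$ reduces to $\mathrm{ANECE}(F)$ in polynomial time (Turing reduction): there are a deterministic oracle Turing machine and a polynomial $p$ such that, with any oracle that answers all instances of $\mathrm{ANECE}(F)$ correctly, the machine decides every instance of $\mathrm{NE}(F)$ of length $s$ in at most $p(s)$ steps, where an oracle query counts as one step. -/

import Mathlib

namespace NeuralNet

/-! ### Feedforward networks -/

/-- A computation node with activation in `F`: its activation function, its bias, and the weights
of its edges from the nodes of the previous layer, in order (an absent edge has weight `0`). -/
structure Neuron (F : Set (ℝ → ℝ)) where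
  activation : F
  bias : ℚ
  weights : List ℚ

/-- A layer of computation nodes. -/
abbrev Layer (F : Set (ℝ → ℝ)) : Type := List (Neuron F)

variable {F : Set (ℝ → ℝ)}

/-- The output `σ (∑ j, c j * y j + b)` of a node when the previous layer has output `y`. -/
noncomputable def Neuron.eval (v : Neuron F) (y : List ℝ) : ℝ :=
  v.activation.1 ((List.zipWith (fun (c : ℚ) (t : ℝ) => (c : ℝ) * t) v.weights y).sum + (v.bias : ℝ))

/-- The output of the last one of a list of consecutive layers, where `y` is the output of the
layer before the first one. -/
noncomputable def evalLayers : List (Layer F) → List ℝ → List ℝ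
  | [], y => y
  | L :: Ls, y => evalLayers Ls (L.map fun v => v.eval y)

/-- Every node has exactly one weight for each node of the previous layer; `n` is the number of
nodes of the layer before the first one. -/
def WellFormed : ℕ → List (Layer F) → Prop
  | _, [] => True
  | n, L :: Ls => (∀ v ∈ L, v.weights.length = n) ∧ WellFormed L.length Ls

/-- A feedforward network with rational weights and biases and activations in `F`: the number of
input nodes, the hidden layers (possibly none), and the output layer. -/
structure Network (F : Set (ℝ → ℝ)) where
  inputs : ℕ
  hidden : List (Layer F)
  output : Layer F
  wellFormed : WellFormed inputs (hidden ++ [output])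

/-- The layers of computation nodes. -/
def Network.layers (N : Network F) : List (Layer F) := N.hidden ++ [N.output]

/-- The output `N(x)` of the network on the input `x`. Vectors are lists, so this is a function
from the lists of length `N.inputs` to the lists of length `N.output.length`. -/
noncomputable def Network.eval (N : Network F) (x : List ℝ) : List ℝ := evalLayers N.layers x

/-- `N` and `M` compute the same function `ℝⁿ → ℝᵐ`; in particular `n` and `m` agree. -/
def SameFunction (N M : Network F) : Prop :=
  N.inputs = M.inputs ∧ N.output.length = M.output.length ∧
    ∀ x : List ℝ, x.length = N.inputs → N.eval x = M.eval x

/-! ### Deleting hidden nodes -/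

/-- `(k, i)` is a hidden node: the `i`-th node of the `k`-th hidden layer (both counted from 0). -/
def Network.IsHiddenNode (N : Network F) (p : ℕ × ℕ) : Prop :=
  ∃ L, N.hidden[p.1]? = some L ∧ p.2 < L.length

/-- The list `l` without its entries at the positions in `s`. -/
def removeAt {α : Type} (s : Finset ℕ) (l : List α) : List α :=
  (l.zipIdx.filter fun a => a.2 ∉ s).map Prod.fst

/-- The positions deleted in layer `ℓ`, where layer `0` is the input layer and layer `k + 1` is the
`k`-th hidden layer. -/
def deletedIn (Y : Finset (ℕ × ℕ)) : ℕ → Finset ℕ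
  | 0 => ∅
  | k + 1 => (Y.filter fun p => p.1 = k).image Prod.snd

/-- Remove the edges from the nodes of the previous layer at the positions in `s`. -/
def Neuron.restrict (s : Finset ℕ) (v : Neuron F) : Neuron F :=
  { v with weights := removeAt s v.weights }

theorem length_removeAt {α β : Type} (s : Finset ℕ) (l : List α) (l' : List β)
    (h : l.length = l'.length) : (removeAt s l).length = (removeAt s l').length := by
  have key : ∀ {γ : Type} (l : List γ),
      (removeAt s l).length = ((List.range' 0 l.length).filter fun i => i ∉ s).length := by
    intro γ l
    rw [← List.zipIdx_map_snd, List.filter_map]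
    simp [removeAt, Function.comp_def]
  rw [key, key, h]

theorem wellFormed_delete (out : Layer F) (Ls : List (Layer F)) :
    ∀ (s : ℕ → Finset ℕ) (l : List ℕ), WellFormed l.length (Ls ++ [out]) →
      WellFormed (removeAt (s 0) l).length
        (Ls.mapIdx (fun k L => (removeAt (s (k + 1)) L).map (Neuron.restrict (s k)))
          ++ [out.map (Neuron.restrict (s Ls.length))]) := by
  induction Ls with
  | nil =>
    intro s l h
    refine ⟨?_, trivial⟩
    intro v hv
    obtain ⟨w, hw, rfl⟩ := List.mem_map.1 hv
    exact length_removeAt _ _ _ (h.1 w hw)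
  | cons L Ls ih =>
    intro s l h
    rw [List.mapIdx_cons]
    refine ⟨?_, ?_⟩
    · intro v hv
      obtain ⟨w, hw, rfl⟩ := List.mem_map.1 hv
      refine length_removeAt _ _ _ (h.1 w ?_)
      obtain ⟨a, ha, rfl⟩ := List.mem_map.1 hw
      exact List.fst_mem_of_mem_zipIdx (List.mem_filter.1 ha).1
    · have := ih (fun k => s (k + 1)) (L.map fun _ => 0) (by simpa using h.2)
      rw [List.length_map, length_removeAt _ _ (L.map fun _ => 0) (by simp)]
      exact this

/-- The network `N \ Y`, obtained by deleting the hidden nodes in `Y` together with their edges;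
all other activations, biases and weights are kept. -/
def Network.delete (N : Network F) (Y : Finset (ℕ × ℕ)) : Network F where
  inputs := N.inputs
  hidden := N.hidden.mapIdx fun k L =>
    (removeAt (deletedIn Y (k + 1)) L).map (Neuron.restrict (deletedIn Y k))
  output := N.output.map (Neuron.restrict (deletedIn Y N.hidden.length))
  wellFormed := by
    have h := wellFormed_delete N.output N.hidden (deletedIn Y) (List.replicate N.inputs 0)
      (by simpa using N.wellFormed)
    have h0 : (removeAt (deletedIn Y 0) (List.replicate N.inputs 0)).length = N.inputs := by
      simp [removeAt, deletedIn]
    rwa [h0] at h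

/-- A set `Y` of hidden nodes is necessary if `N \ Y` does not compute the same function as `N`. -/
def Network.Necessary (N : Network F) (Y : Finset (ℕ × ℕ)) : Prop :=
  ¬ SameFunction N (N.delete Y)

/-- All non-empty sets of hidden nodes are necessary. -/
def Network.AllNecessary (N : Network F) : Prop :=
  ∀ Y : Finset (ℕ × ℕ), Y.Nonempty → (∀ p ∈ Y, N.IsHiddenNode p) → N.Necessary Y

/-! ### Instances as words -/

/-- The alphabet in which instances are written. -/
inductive Symbol where
  | bit (b : Bool)
  | slash
  | endWord
  | endNeuron
  | endLayer
  | endNetwork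
  deriving DecidableEq, Fintype

open _root_.NeuralNet.Symbol

/-- A binary word, ended by the symbol `t`. -/
def encodeBits (t : Symbol) (l : List Bool) : List Symbol := l.map bit ++ [t]

/-- A rational number: sign bit, binary numerator, binary denominator (in lowest terms). -/
def encodeRat (q : ℚ) : List Symbol :=
  bit (decide (q.num < 0)) :: (encodeBits slash q.num.natAbs.bits ++ encodeBits endWord q.den.bits)

/-- A node: the name of its activation, its bias, its weights. -/
def encodeNeuron (name : F ↪ List Bool) (v : Neuron F) : List Symbol :=
  encodeBits endWord (name v.activation) ++ (encodeRat v.bias ++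
    (v.weights.flatMap encodeRat ++ [endNeuron]))

def encodeLayer (name : F ↪ List Bool) (L : Layer F) : List Symbol :=
  L.flatMap (encodeNeuron name) ++ [endLayer]

/-- A network: the number of input nodes in unary, then the layers of computation nodes. -/
def encodeNetwork (name : F ↪ List Bool) (N : Network F) : List Symbol :=
  encodeBits endWord (List.replicate N.inputs true) ++
    (N.layers.flatMap (encodeLayer name) ++ [endNetwork])

/-- Codes under `e` can be read off uniquely from the front of a word. -/
def PrefixInjective {α : Type} (e : α → List Symbol) : Prop :=
  ∀ a b r s, e a ++ r = e b ++ s → a = b ∧ r = s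

theorem PrefixInjective.injective {α : Type} {e : α → List Symbol} (h : PrefixInjective e) :
    Function.Injective e := fun a b hab => (h a b [] [] (by rw [hab])).1

theorem prefixInjective_bits (t : Symbol) (ht : ∀ b, t ≠ bit b) :
    PrefixInjective (encodeBits t) := by
  intro a
  induction a with
  | nil =>
    intro b r s h
    cases b with
    | nil => simpa [encodeBits] using h
    | cons c b =>
      simp only [encodeBits, List.map_nil, List.nil_append, List.cons_append, List.map_cons,
        List.cons.injEq] at h
      exact absurd h.1 (ht c)
  | cons c a ih =>
    intro b r s h
    cases b with
    | nil =>
      simp only [encodeBits, List.map_nil, List.nil_append, List.cons_append, List.map_cons,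
        List.cons.injEq] at h
      exact absurd h.1.symm (ht c)
    | cons d b =>
      simp only [encodeBits, List.map_cons, List.cons_append, List.cons.injEq, bit.injEq] at h
      obtain ⟨h1, h2⟩ := ih b r s h.2
      exact ⟨by rw [h.1, h1], h2⟩

theorem prefixInjective_list {α : Type} {e : α → List Symbol} (he : PrefixInjective e) (t : Symbol)
    (ht : ∀ a, ∃ c w, e a = c :: w ∧ c ≠ t) :
    PrefixInjective fun l : List α => l.flatMap e ++ [t] := by
  intro a
  induction a with
  | nil =>
    intro b r s h
    cases b with
    | nil => simpa using h
    | cons c b =>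
      obtain ⟨x, w, hx, hne⟩ := ht c
      simp only [List.flatMap_nil, List.nil_append, List.flatMap_cons, hx, List.cons_append,
        List.cons.injEq] at h
      exact absurd h.1.symm hne
  | cons c a ih =>
    intro b r s h
    cases b with
    | nil =>
      obtain ⟨x, w, hx, hne⟩ := ht c
      simp only [List.flatMap_nil, List.nil_append, List.flatMap_cons, hx, List.cons_append,
        List.cons.injEq] at h
      exact absurd h.1 hne
    | cons d b =>
      simp only [List.flatMap_cons, List.append_assoc] at h
      obtain ⟨h1, h2⟩ := he _ _ _ _ h
      obtain ⟨h3, h4⟩ := ih b r s (by simpa using h2)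
      exact ⟨by rw [h1, h3], h4⟩

theorem bits_injective : Function.Injective Nat.bits := fun m n h =>
  Nat.digits_inj_iff.1 (by rw [Nat.digits_two_eq_bits, Nat.digits_two_eq_bits, h])

theorem prefixInjective_rat : PrefixInjective encodeRat := by
  intro p q r s h
  simp only [encodeRat, List.cons_append, List.append_assoc, List.cons.injEq, bit.injEq] at h
  obtain ⟨h1, h2⟩ := h
  obtain ⟨h3, h4⟩ := prefixInjective_bits slash (by simp) _ _ _ _ h2
  obtain ⟨h5, h6⟩ := prefixInjective_bits endWord (by simp) _ _ _ _ h4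
  refine ⟨Rat.ext ?_ ?_, h6⟩
  · have h7 : p.num.natAbs = q.num.natAbs := bits_injective h3
    have h8 : p.num < 0 ↔ q.num < 0 := by simpa using h1
    omega
  · exact bits_injective h5

theorem prefixInjective_neuron (name : F ↪ List Bool) : PrefixInjective (encodeNeuron name) := by
  intro v w r s h
  simp only [encodeNeuron, List.append_assoc] at h
  obtain ⟨h1, h2⟩ := prefixInjective_bits endWord (by simp) _ _ _ _ h
  obtain ⟨h3, h4⟩ := prefixInjective_rat _ _ _ _ h2
  obtain ⟨h5, h6⟩ := prefixInjective_list prefixInjective_rat endNeuron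
    (fun a => ⟨_, _, rfl, by simp⟩) v.weights w.weights r s (by simpa using h4)
  cases v
  cases w
  exact ⟨by simp_all, h6⟩

theorem prefixInjective_layer (name : F ↪ List Bool) : PrefixInjective (encodeLayer name) := by
  refine prefixInjective_list (prefixInjective_neuron name) endLayer fun v => ?_
  rcases h : name v.activation with _ | ⟨c, w⟩ <;>
    exact ⟨_, _, by simp only [encodeNeuron, encodeBits, h, List.map_nil, List.map_cons,
      List.nil_append, List.cons_append]; rfl, by simp⟩

theorem prefixInjective_network (name : F ↪ List Bool) :
    PrefixInjective (encodeNetwork name) := by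
  intro N M r s h
  simp only [encodeNetwork, List.append_assoc] at h
  obtain ⟨h1, h2⟩ := prefixInjective_bits endWord (by simp) _ _ _ _ h
  obtain ⟨h3, h4⟩ := prefixInjective_list (prefixInjective_layer name) endNetwork
    (fun L => by
      rcases L with _ | ⟨v, L⟩
      · exact ⟨_, _, rfl, by simp⟩
      · rcases h : name v.activation with _ | ⟨c, w⟩ <;>
          exact ⟨_, _, by simp only [encodeLayer, List.flatMap_cons, encodeNeuron, encodeBits, h,
            List.map_nil, List.map_cons, List.nil_append, List.cons_append]; rfl, by simp⟩)
    N.layers M.layers r s (by simpa using h2)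
  have h5 : N.inputs = M.inputs := by simpa using congrArg List.length h1
  obtain ⟨h6, h7⟩ := List.append_inj' h3 rfl
  cases N
  cases M
  simp_all

/-! ### Decision problems and polynomial-time reductions -/

/-- A decision problem: its instances, each written as a word, and the question. -/
structure DecisionProblem where
  Instance : Type
  code : Instance → List Symbol
  code_injective : Function.Injective code
  Holds : Instance → Prop

/-- Network equivalence: do two given `F`-networks compute the same function? -/
def NE (F : Set (ℝ → ℝ)) (name : F ↪ List Bool) : DecisionProblem where
  Instance := Network F × Network F
  code P := encodeNetwork name P.1 ++ encodeNetwork name P.2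
  code_injective P Q h := by
    obtain ⟨h1, h2⟩ := prefixInjective_network name _ _ _ _ h
    exact Prod.ext h1 ((prefixInjective_network name).injective h2)
  Holds P := SameFunction P.1 P.2

/-- Are all non-empty sets of hidden nodes of a given `F`-network necessary? -/
def ANECE (F : Set (ℝ → ℝ)) (name : F ↪ List Bool) : DecisionProblem where
  Instance := Network F
  code := encodeNetwork name
  code_injective := (prefixInjective_network name).injective
  Holds N := N.AllNecessary

/-- A deterministic multi-tape Turing machine with an oracle: Mathlib's finite multi-stack model
`TM2` (a tape is a pair of stacks) with a query stack and three labels for oracle queries. -/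
structure OracleMachine where
  /-- the stacks -/
  K : Type
  [decEqK : DecidableEq K]
  [finK : Fintype K]
  /-- the stack alphabet -/
  Γ : Type
  [finΓ : Fintype Γ]
  /-- the labels of the program -/
  Λ : Type
  [finΛ : Fintype Λ]
  /-- the internal states -/
  σ : Type
  [finσ : Fintype σ]
  /-- the input alphabet as a part of the stack alphabet -/
  sym : Symbol ↪ Γ
  inputStack : K
  queryStack : K
  main : Λ
  start : σ
  program : Λ → Turing.TM2.Stmt (fun _ : K => Γ) Λ σ
  /-- the label at which the oracle is asked, and the labels at which the run goes on -/
  query : Λ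
  yes : Λ
  no : Λ
  /-- the internal states in which halting means acceptance -/
  accept : σ → Bool

namespace OracleMachine

variable (M : OracleMachine)

instance : DecidableEq M.K := M.decEqK

/-- Configurations: current label (`none` if halted), internal state, contents of the stacks. -/
abbrev Cfg : Type := Turing.TM2.Cfg (fun _ : M.K => M.Γ) M.Λ M.σ

/-- The initial configuration on the input word `w`. -/
def init (w : List Symbol) : M.Cfg where
  l := some M.main
  var := M.start
  stk k := if k = M.inputStack then w.map M.sym else []

open Classical in
/-- One step with oracle `O`. At the label `query`, the oracle tells in one step whether the word
on the query stack lies in `O`, and that stack is emptied; at the others it is a step of `TM2`. -/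
noncomputable def step (O : Set (List Symbol)) (c : M.Cfg) : Option M.Cfg :=
  if c.l = some M.query then
    some
      { l := some (if ∃ w ∈ O, c.stk M.queryStack = w.map M.sym then M.yes else M.no)
        var := c.var
        stk := Function.update c.stk M.queryStack [] }
  else Turing.TM2.step M.program c

/-- With oracle `O`, on input `w`, the machine halts after at most `t` steps, and it accepts if and
only if `P` holds. -/
def DecidesIn (O : Set (List Symbol)) (w : List Symbol) (t : ℕ) (P : Prop) : Prop :=
  ∃ c : M.Cfg, Nonempty (StateTransition.EvalsToInTime (M.step O) (M.init w) (some c) t) ∧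
    c.l = none ∧ (M.accept c.var = true ↔ P)

end OracleMachine

/-- Polynomial-time (Turing) reducibility: some oracle machine, run on instances of `A`, decides `A`
in polynomial time, given any oracle that answers all instances of `B` correctly. -/
def DecisionProblem.PolyTimeReducesTo (A B : DecisionProblem) : Prop :=
  ∃ (M : OracleMachine) (p : Polynomial ℕ), ∀ O : Set (List Symbol),
    (∀ b : B.Instance, B.code b ∈ O ↔ B.Holds b) →
      ∀ a : A.Instance, M.DecidesIn O (A.code a) (p.eval (A.code a).length) (A.Holds a)

end NeuralNet

namespace NeuralNet

open _root_.NeuralNet.Symbol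
open Turing
open Function (update)

/-! ### A structured programming language for oracle machines -/

/-! The reduction finds out, node by node, which nodes compute the zero function, and each such
question costs one oracle query. Suppose that nonzero functions `f₁, …, f_r` are computed by layers
each of which begins with identity copies of all nodes of the layer before (`Carry`, `Computes`). To
test a further node `u` that depends on these functions, append a layer consisting of copies of the
`f_i` together with `u`, and let the output layer copy all `r + 1` values. Deleting a hidden node
has the same effect as replacing its output by `0` (`evalLayers_delete`). If `u` vanishes
identically, then deleting `u` alone changes nothing. If `u` does not vanish and a set `Y` contains
the node at position `i` of some hidden layer, then the identity copies carry the value `0` from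
there to the `i`-th output, although the `i`-th output of the full network is a nonzero function; so
`Y` is necessary. Hence the query network is a yes-instance exactly when `u` is nonzero
(`Computes.allNecessary_network`).

A nonzero `u` joins the carried functions. A zero `u` is dropped, together with all later weights
from it, which does not alter any later sum (`dot_expand`). The coordinate functions of the input
are nonzero, so the process can start with no layers at all. In this way the nodes of the first
network are tested, then those of the second network on the same inputs, and finally one identity
node for each difference of corresponding outputs. After the numbers of inputs and outputs have been
compared, the networks agree if and only if every difference turns out to be zero.

The number of queries is linear. Each value contributes at most one layer, the width is at most the
number of values, and the weights and biases are either copied from the input or are `0`, `1`, `-1`;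
so the queries have polynomial size.

The machine is obtained from a small language `Prog` with a step-counting semantics `Exec`, which
compiles to `TM2` with the same number of steps (`exec_code`). The programs only move symbols
between stacks and count in unary. `runs_readNode`, `runs_readLayers` and `runs_equivalence` connect
the stack contents with the invariant `Valid`. All time bounds are deliberately crude. -/

/-- Whether a value can be used by the current layer, belongs to it, or neither. -/
inductive Status where
  | old
  | prev
  | cur
  deriving DecidableEq

instance : Fintype Status := ⟨{.old, .prev, .cur}, by rintro (_ | _ | _) <;> simp⟩

/-- What the machine remembers about a value: whether it is an input, whether it is an output of
the first network, its status, and whether it is not the zero function. -/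
structure Tag where
  isInput : Bool
  isOutput : Bool
  status : Status
  kept : Bool
  deriving DecidableEq, Fintype

/-- Stack symbols. -/
abbrev Cell : Type := Symbol ⊕ Tag

abbrev Word : Type := List Cell

/-- The stacks. -/
inductive Stack where
  | input
  | query
  | layer
  | out
  | pre
  | tags
  | tags'
  | units
  | units'
  | temp
  | count₁
  | count₂
  | count₃
  | fail
  deriving DecidableEq

instance : Fintype Stack where
  elems := {.input, .query, .layer, .out, .pre, .tags, .tags', .units, .units', .temp, .count₁,
    .count₂, .count₃, .fail}
  complete k := by cases k <;> simp

/-- Structured programs. `loop k body again` pops a symbol `o` from `k` (`none` if `k` is empty),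
runs `body o`, and starts again if `again o`. `ask` asks the oracle and pushes its answer to the
query stack. -/
inductive Prog where
  | skip
  | push (k : Stack) (g : Cell)
  | seq (p q : Prog)
  | loop (k : Stack) (body : Option Cell → Prog) (again : Option Cell → Bool)
  | ask

infixr:60 " ;; " => Prog.seq

/-- The contents of the stacks. -/
abbrev Store : Type := Stack → Word

open Classical in
/-- The answer of the oracle `O` to the query `w`. -/
noncomputable def answer (O : Set (List Symbol)) (w : Word) : Cell :=
  .inl (bit (decide (∃ u ∈ O, w = u.map Sum.inl)))

/-- `Exec O p s s' t`: with oracle `O`, the program `p` takes the store `s` to `s'` in `t` steps. -/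
inductive Exec (O : Set (List Symbol)) : Prog → Store → Store → ℕ → Prop
  | skip (s) : Exec O .skip s s 1
  | push (k g s) : Exec O (.push k g) s (update s k (g :: s k)) 1
  | seq {p q s₁ s₂ s₃ t₁ t₂} : Exec O p s₁ s₂ t₁ → Exec O q s₂ s₃ t₂ →
      Exec O (p ;; q) s₁ s₃ (t₁ + t₂)
  | leave {k body again s s' t} : again (s k).head? = false →
      Exec O (body (s k).head?) (update s k (s k).tail) s' t →
      Exec O (.loop k body again) s s' (1 + t)
  | next {k body again s s₁ s₂ t₁ t₂} : again (s k).head? = true →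
      Exec O (body (s k).head?) (update s k (s k).tail) s₁ t₁ →
      Exec O (.loop k body again) s₁ s₂ t₂ →
      Exec O (.loop k body again) s s₂ (1 + t₁ + t₂)
  | ask (s) : Exec O .ask s (update s .query [answer O (s .query)]) 3

/-! ### Compilation -/

/-- The labels in the code of a program. -/
def Lab : Prog → Type
  | .skip => Unit
  | .push _ _ => Unit
  | .seq p q => Lab p ⊕ Lab q
  | .loop _ body _ => Unit ⊕ Σ o, Lab (body o)
  | .ask => Unit

/-- This rests on the finiteness of the stack alphabet: a loop contains one body for each symbol
that can be popped, and one for the empty stack. -/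
instance finite_lab : (p : Prog) → Finite (Lab p)
  | .skip => inferInstanceAs (Finite Unit)
  | .push _ _ => inferInstanceAs (Finite Unit)
  | .seq p q =>
    have := finite_lab p
    have := finite_lab q
    inferInstanceAs (Finite (Lab p ⊕ Lab q))
  | .loop _ body _ =>
    have := fun o => finite_lab (body o)
    inferInstanceAs (Finite (Unit ⊕ Σ o, Lab (body o)))
  | .ask => inferInstanceAs (Finite Unit)

/-- Labels outside the code of the program. -/
inductive Control where
  | query
  | yes
  | no
  | done
  deriving DecidableEq

instance : Fintype Control where
  elems := {.query, .yes, .no, .done}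
  complete c := by cases c <;> simp

/-- The first label in the code of a program. -/
def entry : (p : Prog) → Lab p
  | .skip => ()
  | .push _ _ => ()
  | .seq p _ => Sum.inl (entry p)
  | .loop _ _ _ => Sum.inl ()
  | .ask => ()

/-- The internal states: the last symbol that was popped, and the label at which the run goes on
after a query. -/
abbrev PState (L : Type) : Type := Option Cell × (L ⊕ Control)

/-- The code of a program, where `emb` embeds its labels and `exit` is where to go at the end. -/
def code {L : Type} : (p : Prog) → (emb : Lab p → L) → (exit : L ⊕ Control) → Lab p →
    TM2.Stmt (fun _ : Stack => Cell) (L ⊕ Control) (PState L)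
  | .skip, _, exit, _ => .goto fun _ => exit
  | .push k g, _, exit, _ => .push k (fun _ => g) (.goto fun _ => exit)
  | .seq p q, emb, _, .inl l =>
    code p (fun l => emb (.inl l)) (.inl (emb (.inr (entry q)))) l
  | .seq _ q, emb, exit, .inr l => code q (fun l => emb (.inr l)) exit l
  | .loop k body _, emb, _, .inl _ =>
    .pop k (fun v o => (o, v.2)) (.goto fun v => .inl (emb (.inr ⟨v.1, entry (body v.1)⟩)))
  | .loop _ body again, emb, exit, .inr ⟨o, l⟩ =>
    code (body o) (fun l => emb (.inr ⟨o, l⟩)) (if again o then .inl (emb (.inl ())) else exit) l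
  | .ask, _, exit, _ => .load (fun v => (v.1, exit)) (.goto fun _ => .inr .query)

/-- The oracle machine that runs `p` and accepts if the stack `fail` is empty at the end. -/
noncomputable def Prog.machine (p : Prog) : OracleMachine where
  K := Stack
  Γ := Cell
  Λ := Lab p ⊕ Control
  finΛ := Fintype.ofFinite _
  σ := PState (Lab p)
  finσ := Fintype.ofFinite _
  sym := Function.Embedding.inl
  inputStack := .input
  queryStack := .query
  main := .inl (entry p)
  start := (none, .inr .done)
  program
    | .inl l => code p id (.inr .done) l
    | .inr .query => .halt
    | .inr .yes => .push .query (fun _ => .inl (bit true)) (.goto fun v => v.2)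
    | .inr .no => .push .query (fun _ => .inl (bit false)) (.goto fun v => v.2)
    | .inr .done => .pop .fail (fun v o => (o, v.2)) .halt
  query := .inr .query
  yes := .inr .yes
  no := .inr .no
  accept v := v.1.isNone

theorem iterate_one {α : Type} {f : α → Option α} {a : α} :
    (flip bind f)^[1] (some a) = f a := rfl

theorem iterate_some_add {α : Type} {f : α → Option α} {a b : α} {c : Option α} {m n : ℕ}
    (h₁ : (flip bind f)^[m] (some a) = some b) (h₂ : (flip bind f)^[n] (some b) = c) :
    (flip bind f)^[m + n] (some a) = c := by
  rw [Nat.add_comm, Function.iterate_add_apply, h₁, h₂]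

theorem step_of_ne {M : OracleMachine} {O : Set (List Symbol)} {c : M.Cfg}
    (h : c.l ≠ some M.query) : M.step O c = TM2.step M.program c := if_neg h

theorem step_query_pos {M : OracleMachine} {O : Set (List Symbol)} {c : M.Cfg}
    (h : c.l = some M.query) (hq : ∃ w ∈ O, c.stk M.queryStack = w.map M.sym) :
    M.step O c = some ⟨some M.yes, c.var, update c.stk M.queryStack []⟩ := by
  rw [OracleMachine.step, if_pos h, if_pos hq]

theorem step_query_neg {M : OracleMachine} {O : Set (List Symbol)} {c : M.Cfg}
    (h : c.l = some M.query) (hq : ¬ ∃ w ∈ O, c.stk M.queryStack = w.map M.sym) :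
    M.step O c = some ⟨some M.no, c.var, update c.stk M.queryStack []⟩ := by
  rw [OracleMachine.step, if_pos h, if_neg hq]

-- Simulation by induction on the derivation of `Exec`, so the step counts agree exactly. The
-- subprogram sits inside an ambient program `P` through `emb`, and the internal state is arbitrary
-- on entry, because every state that matters is written before it is used.
open Classical in
theorem exec_code {O : Set (List Symbol)} {P p : Prog} {s s' : Store} {t : ℕ}
    (h : Exec O p s s' t) : ∀ (emb : Lab p → Lab P) (exit : Lab P ⊕ Control),
    (∀ l, P.machine.program (.inl (emb l)) = code p emb exit l) → ∀ v : PState (Lab P),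
    ∃ v' : PState (Lab P), (flip bind (P.machine.step O))^[t]
      (some (⟨some (.inl (emb (entry p))), v, s⟩ : P.machine.Cfg)) = some ⟨some exit, v', s'⟩ := by
  have one : ∀ (l : Lab P) (v : PState (Lab P)) (s : Store),
      P.machine.step O ⟨some (.inl l), v, s⟩ =
        some (Turing.TM2.stepAux (P.machine.program (.inl l)) v s) := by
    intro l v s
    rw [OracleMachine.step, if_neg]
    · rfl
    · intro h
      cases h
  induction h with
  | skip s =>
    intro emb exit hP v
    refine ⟨v, ?_⟩
    change P.machine.step O _ = _
    rw [one, hP]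
    rfl
  | push k g s =>
    intro emb exit hP v
    refine ⟨v, ?_⟩
    change P.machine.step O _ = _
    rw [one, hP]
    rfl
  | seq _ _ ih₁ ih₂ =>
    intro emb exit hP v
    obtain ⟨v₁, h₁⟩ := ih₁ (fun l => emb (.inl l)) _ (fun l => hP (.inl l)) v
    obtain ⟨v₂, h₂⟩ := ih₂ (fun l => emb (.inr l)) _ (fun l => hP (.inr l)) v₁
    exact ⟨v₂, iterate_some_add h₁ h₂⟩
  | @leave k body again s s' t ha _ ih =>
    intro emb exit hP v
    obtain ⟨v₁, h₁⟩ := ih (fun l => emb (.inr ⟨_, l⟩)) exit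
      (fun l => (hP (.inr ⟨_, l⟩)).trans (by simp [code, ha]; rfl)) ((s k).head?, v.2)
    refine ⟨v₁, iterate_some_add ?_ h₁⟩
    change P.machine.step O _ = _
    rw [one, hP]
    rfl
  | @next k body again s s₁ s₂ t₁ t₂ ha _ _ ih₁ ih₂ =>
    intro emb exit hP v
    obtain ⟨v₁, h₁⟩ := ih₁ (fun l => emb (.inr ⟨_, l⟩)) (.inl (emb (.inl ())))
      (fun l => (hP (.inr ⟨_, l⟩)).trans (by simp [code, ha]; rfl)) ((s k).head?, v.2)
    obtain ⟨v₂, h₂⟩ := ih₂ emb exit hP v₁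
    refine ⟨v₂, iterate_some_add (iterate_some_add ?_ h₁) h₂⟩
    change P.machine.step O _ = _
    rw [one, hP]
    rfl
  | ask s =>
    intro emb exit hP v
    -- A machine has only one query label, so the return label is saved in the internal state. The
    -- three steps are saving it, asking the oracle, and pushing the answer.
    refine ⟨(v.1, exit), ?_⟩
    have h₁ : P.machine.step O ⟨some (.inl (emb ())), v, s⟩ =
        some ⟨some (.inr .query), (v.1, exit), s⟩ := by
      exact (one _ _ _).trans (by rw [hP ()]; rfl)
    have h₂ : P.machine.step O ⟨some (.inr .query), (v.1, exit), s⟩ =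
        some ⟨some (.inr (if ∃ w ∈ O, s .query = w.map Sum.inl then .yes else .no)),
          (v.1, exit), update s .query []⟩ := by
      by_cases hq : ∃ w ∈ O, s .query = w.map Sum.inl
      · exact (step_query_pos rfl hq).trans (by rw [if_pos hq]; rfl)
      · exact (step_query_neg rfl hq).trans (by rw [if_neg hq]; rfl)
    have h₃ : P.machine.step O
        ⟨some (.inr (if ∃ w ∈ O, s .query = w.map Sum.inl then .yes else .no)),
          (v.1, exit), update s .query []⟩ =
        some ⟨some exit, (v.1, exit), update s .query [answer O (s .query)]⟩ := by
      have hu : ∀ g : Cell, update (update s .query []) .query (g :: update s .query [] .query) =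
          update s .query [g] := by simp
      by_cases hq : ∃ w ∈ O, s .query = w.map Sum.inl
      · rw [if_pos hq, answer, decide_eq_true hq]
        exact (step_of_ne (by intro h; cases h)).trans
          (congrArg (fun S => some (⟨some exit, (v.1, exit), S⟩ : P.machine.Cfg)) (hu _))
      · rw [if_neg hq, answer, decide_eq_false hq]
        exact (step_of_ne (by intro h; cases h)).trans
          (congrArg (fun S => some (⟨some exit, (v.1, exit), S⟩ : P.machine.Cfg)) (hu _))
    exact iterate_some_add (iterate_some_add (iterate_one.trans h₁) (iterate_one.trans h₂))
      (iterate_one.trans h₃)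

/-! ### Running a compiled program on an input word -/

/-- The store with input `w`. -/
def inputStore (w : List Symbol) : Store := fun k => if k = .input then w.map Sum.inl else []

/-- The additional step is the pop of `fail` at the label `done`: the popped symbol is stored in the
internal state, and `accept` tests whether there was one. -/
theorem Exec.decidesIn {O : Set (List Symbol)} {p : Prog} {w : List Symbol} {s : Store} {t T : ℕ}
    {P : Prop} (h : Exec O p (inputStore w) s t) (ht : t + 1 ≤ T) (hP : s .fail = [] ↔ P) :
    p.machine.DecidesIn O w T P := by
  obtain ⟨v, hv⟩ := exec_code h (P := p) id (.inr .done) (fun _ => rfl) (none, .inr .done)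
  refine ⟨⟨none, ((s .fail).head?, v.2), update s .fail (s .fail).tail⟩, ⟨⟨t + 1, ?_⟩, ht⟩,
    rfl, ?_⟩
  · refine iterate_some_add hv ?_
    change p.machine.step O _ = _
    rw [OracleMachine.step, if_neg (by intro h; cases h)]
    rfl
  · rw [← hP]
    cases s .fail <;> simp [Prog.machine]

/-- `Runs O p s s' T`: with oracle `O`, the program `p` takes `s` to `s'` in at most `T` steps. -/
def Runs (O : Set (List Symbol)) (p : Prog) (s s' : Store) (T : ℕ) : Prop :=
  ∃ t ≤ T, Exec O p s s' t

/-! ### Rules for programs -/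

section Rules

variable {O : Set (List Symbol)} {p q : Prog} {s s₁ s₂ s₃ : Store} {T T₁ T₂ : ℕ}

theorem Runs.mono (h : Runs O p s₁ s₂ T₁) (hT : T₁ ≤ T₂) : Runs O p s₁ s₂ T₂ :=
  let ⟨t, ht, h⟩ := h
  ⟨t, ht.trans hT, h⟩

theorem Runs.congr (h : Runs O p s₁ s₂ T₁) (hs : s₂ = s₃) (hT : T₁ ≤ T₂) : Runs O p s₁ s₃ T₂ :=
  hs ▸ h.mono hT

theorem Runs.conv (h : Runs O p s₁ s₂ T₁) (hs : s₁ = s) (hs' : s₂ = s₃) (hT : T₁ ≤ T₂) :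
    Runs O p s s₃ T₂ := hs ▸ h.congr hs' hT

theorem Runs.skip : Runs O .skip s s 1 := ⟨1, le_rfl, .skip s⟩

theorem Runs.push (k : Stack) (g : Cell) : Runs O (.push k g) s (update s k (g :: s k)) 1 :=
  ⟨1, le_rfl, .push k g s⟩

theorem Runs.ask : Runs O .ask s (update s .query [answer O (s .query)]) 3 := ⟨3, le_rfl, .ask s⟩

theorem Runs.seq (h₁ : Runs O p s₁ s₂ T₁) (h₂ : Runs O q s₂ s₃ T₂) :
    Runs O (p ;; q) s₁ s₃ (T₁ + T₂) :=
  let ⟨t₁, ht₁, h₁⟩ := h₁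
  let ⟨t₂, ht₂, h₂⟩ := h₂
  ⟨t₁ + t₂, add_le_add ht₁ ht₂, .seq h₁ h₂⟩

theorem Runs.leave {k : Stack} {body : Option Cell → Prog} {again : Option Cell → Bool}
    (ha : again (s k).head? = false)
    (h : Runs O (body (s k).head?) (update s k (s k).tail) s₁ T) :
    Runs O (.loop k body again) s s₁ (1 + T) :=
  let ⟨t, ht, h⟩ := h
  ⟨1 + t, by omega, .leave ha h⟩

theorem Runs.next {k : Stack} {body : Option Cell → Prog} {again : Option Cell → Bool}
    (ha : again (s k).head? = true)
    (h₁ : Runs O (body (s k).head?) (update s k (s k).tail) s₁ T₁)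
    (h₂ : Runs O (.loop k body again) s₁ s₂ T₂) :
    Runs O (.loop k body again) s s₂ (1 + T₁ + T₂) :=
  let ⟨t₁, ht₁, h₁⟩ := h₁
  let ⟨t₂, ht₂, h₂⟩ := h₂
  ⟨1 + t₁ + t₂, by omega, .next ha h₁ h₂⟩

/-- Pop a symbol and branch. -/
def pop (k : Stack) (f : Option Cell → Prog) : Prog := .loop k f fun _ => false

theorem Runs.pop {k : Stack} {f : Option Cell → Prog}
    (h : Runs O (f (s k).head?) (update s k (s k).tail) s₁ T) :
    Runs O (pop k f) s s₁ (1 + T) := Runs.leave rfl h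

/-- Empty the stack `k` and run `f g` for each of the symbols `g`. -/
def each (k : Stack) (f : Cell → Prog) : Prog := .loop k (fun o => o.elim .skip f) Option.isSome

theorem Runs.each_nil {k : Stack} {f : Cell → Prog} (h : s k = []) : Runs O (each k f) s s 2 := by
  have := Runs.leave (O := O) (s := s) (k := k) (body := fun o => o.elim .skip f)
    (again := Option.isSome) (by simp [h]) (by rw [h]; exact Runs.skip)
  refine this.congr ?_ le_rfl
  rw [← h]
  simp [h]

theorem Runs.each_cons {k : Stack} {f : Cell → Prog} {g : Cell} {w : Word} (h : s k = g :: w)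
    (h₁ : Runs O (f g) (update s k w) s₁ T₁) (h₂ : Runs O (each k f) s₁ s₂ T₂) :
    Runs O (each k f) s s₂ (1 + T₁ + T₂) :=
  Runs.next (by simp [h]) (by rw [h]; exact h₁) h₂

/-- `S d r` is the store when the symbols in `d` have been processed and those in `r` have not. -/
theorem Runs.each {k : Stack} {f : Cell → Prog} {w : Word} (S : Word → Word → Store)
    (hk : ∀ d r, S d r k = r)
    (hS : ∀ d g r, w = d ++ g :: r →
      Runs O (f g) (update (S d (g :: r)) k r) (S (d ++ [g]) r) T) :
    Runs O (each k f) (S [] w) (S w []) (w.length * (T + 1) + 2) := by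
  have : ∀ r d, w = d ++ r → Runs O (NeuralNet.each k f) (S d r) (S w [])
      (r.length * (T + 1) + 2) := by
    intro r
    induction r with
    | nil =>
      intro d hd
      rw [hd, List.append_nil]
      exact (Runs.each_nil (hk d [])).mono (by simp)
    | cons g r ih =>
      intro d hd
      refine (Runs.each_cons (hk d _) (hS d g r hd) (ih (d ++ [g]) (by simp [hd]))).mono ?_
      rw [List.length_cons]
      nlinarith
  exact this w [] rfl

/-- Run `f g` for each symbol `g` that is popped from the input, up to and including `endWord`. -/
def readWord (f : Cell → Prog) : Prog :=
  .loop .input (fun o => o.elim .skip f) fun o => o.isSome && !decide (o = some (.inl endWord))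

/-- As for `each`, with `S d r` as loop invariant. The body also processes the terminator `endWord`,
which accounts for `w.length + 1` rounds. -/
theorem Runs.readWord {f : Cell → Prog} {w r : Word} (S : Word → Word → Store)
    (hk : ∀ d r, S d r .input = r) (hw : .inl endWord ∉ w)
    (hS : ∀ d g v, Runs O (f g) (update (S d (g :: v)) .input v) (S (d ++ [g]) v) T) :
    Runs O (readWord f) (S [] (w ++ .inl endWord :: r)) (S (w ++ [.inl endWord]) r)
      ((w.length + 1) * (T + 1)) := by
  have : ∀ v d, .inl endWord ∉ v → Runs O (NeuralNet.readWord f) (S d (v ++ .inl endWord :: r))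
      (S (d ++ (v ++ [.inl endWord])) r) ((v.length + 1) * (T + 1)) := by
    intro v
    induction v with
    | nil =>
      intro d _
      exact (Runs.leave (by simp [hk]) (by simpa [hk] using hS d (.inl endWord) r)).mono
        (by simp; omega)
    | cons g v ih =>
      intro d hv
      have hne : g ≠ .inl endWord := fun h => hv (by simp [h])
      have := ih (d ++ [g]) (fun h => hv (by simp [h]))
      refine (Runs.next (T₁ := T) (by simp [hk, hne]) ?_
        (by rwa [List.append_assoc, List.singleton_append] at this)).mono ?_
      · simpa [hk] using hS d g _
      · rw [List.length_cons]
        nlinarith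
  exact this w [] hw

/-- Push the symbols of `w`. -/
def emit (k : Stack) (w : Word) : Prog := w.foldr (fun g p => .push k g ;; p) .skip

theorem Runs.emit (k : Stack) (w : Word) :
    Runs O (emit k w) s (update s k (w.reverse ++ s k)) (w.length + 1) := by
  induction w generalizing s with
  | nil => exact Runs.skip.congr (by simp) le_rfl
  | cons g w ih =>
    refine ((Runs.push k g).seq ih).congr ?_ (by simp; omega)
    simp

/-- Move `a` to `b`, which reverses it. -/
def move (a b : Stack) : Prog := each a (.push b)

theorem Runs.move {a b : Stack} (hab : a ≠ b) :
    Runs O (move a b) s (update (update s a []) b ((s a).reverse ++ s b))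
      (2 * (s a).length + 2) := by
  refine (Runs.each (T := 1) (fun d r => update (update s a r) b (d.reverse ++ s b))
    (fun d r => ?_) (fun d g r _ => ?_)).conv (by simp) rfl (by omega)
  · simp [hab]
  · refine (Runs.push b g).congr ?_ le_rfl
    funext j; simp only [Function.update_apply]; split_ifs <;> simp_all

/-- Move `a` to both `b` and `c`. -/
def copy (a b c : Stack) : Prog := each a fun g => .push b g ;; .push c g

theorem Runs.copy {a b c : Stack} (hab : a ≠ b) (hac : a ≠ c) (hbc : b ≠ c) :
    Runs O (copy a b c) s (update (update (update s a []) b ((s a).reverse ++ s b)) c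
      ((s a).reverse ++ s c)) (3 * (s a).length + 2) := by
  refine (Runs.each (T := 2)
    (fun d r => update (update (update s a r) b (d.reverse ++ s b)) c (d.reverse ++ s c))
    (fun d r => ?_) (fun d g r _ => ?_)).conv (by simp) rfl (by omega)
  · simp [hab, hac]
  · refine ((Runs.push b g).seq (Runs.push c g)).congr ?_ le_rfl
    funext j; simp only [Function.update_apply]; split_ifs <;> simp_all

/-! ### Writing square arrays whose size is given in unary -/

/-- `n` copies of `w`. -/
def rep (n : ℕ) (w : Word) : Word := (List.replicate n w).flatten

/-- Push a copy of `w` to `k` for each symbol on `a`. -/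
def fill (a k : Stack) (w : Word) : Prog :=
  each a (fun g => emit k w ;; .push .temp g) ;; move .temp a

theorem rep_succ' (n : ℕ) (w : Word) : rep (n + 1) w = rep n w ++ w := by
  simp [rep, List.replicate_succ']

/-- The counter `a` is moved to `temp` while the copies are pushed, and the second move undoes the
reversal, so the counter survives. -/
theorem Runs.fill {a k : Stack} {w : Word} (hak : a ≠ k) (ha : a ≠ .temp) (hk : k ≠ .temp)
    (ht : s .temp = []) :
    Runs O (fill a k w) s (update s k ((rep (s a).length w).reverse ++ s k))
      (((s a).length + 1) * (w.length + 5)) := by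
  have h : Runs O (NeuralNet.each a fun g => NeuralNet.emit k w ;; .push .temp g) s
      (update (update (update s a []) k ((rep (s a).length w).reverse ++ s k)) .temp
        (s a).reverse) ((s a).length * (w.length + 1 + 1 + 1) + 2) := by
    refine (Runs.each (fun d r => update (update (update s a r) k
      ((rep d.length w).reverse ++ s k)) .temp d.reverse)
      (fun d r => ?_) (fun d g r _ => ?_)).conv ?_ rfl le_rfl
    · simp [ha, hak]
    · refine ((Runs.emit k w).seq (Runs.push .temp g)).congr ?_ le_rfl
      funext j; simp only [Function.update_apply, List.length_append, List.length_singleton,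
        rep_succ', List.reverse_append]; split_ifs <;> simp_all
    · funext j; simp only [Function.update_apply]; split_ifs <;> simp_all [rep]
  refine (h.seq (Runs.move ha.symm)).congr ?_ ?_
  · funext j; simp only [Function.update_apply]; split_ifs <;> simp_all
  · simp
    nlinarith

/-- The row of length `i + 1 + r` with entry `c` at position `i` and entries `z` elsewhere. -/
def row (z : Word) (i r : ℕ) (c : Word) : Word := rep i z ++ c ++ rep r z

/-- A line consisting of `hd`, a row for each of the entries `cs`, and `tl`. -/
def line (z hd tl : Word) (cs : List Word) (i r : ℕ) : Word :=
  hd ++ cs.flatMap (row z i r) ++ tl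

/-- The lines of a square array. -/
def square (z hd tl : Word) (cs : List Word) (n : ℕ) : Word :=
  (List.range n).flatMap fun i => line z hd tl cs i (n - 1 - i)

/-- Push a square array to `k`; its size is the number of symbols on `a`. -/
def emitSquare (a k : Stack) (z hd tl : Word) (cs : List Word) : Prog :=
  each a (fun g => emit k hd ;;
    cs.foldr (fun c p => fill .units' k z ;; emit k c ;; fill a k z ;; p) .skip ;;
    emit k tl ;; .push .units' g) ;; move .units' a

/-- In pass `i` of `emitSquare`, the stack `units'` holds the `i` symbols already passed and `a`
those still to come. These are unary counters for the zeros before and after the single entry of a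
row. -/
theorem Runs.rows {a k : Stack} {z : Word} {L : ℕ} (hz : z.length ≤ L) (cs : List Word)
    (hcs : ∀ c ∈ cs, c.length ≤ L) (hak : a ≠ k) (ha : a ≠ .temp) (hk : k ≠ .temp)
    (hk' : k ≠ .units') (ht : s .temp = []) :
    Runs O (cs.foldr (fun c p => NeuralNet.fill .units' k z ;; NeuralNet.emit k c ;;
      NeuralNet.fill a k z ;; p) .skip) s
      (update s k ((cs.flatMap (row z (s .units').length (s a).length)).reverse ++ s k))
      (cs.length * (((s .units').length + (s a).length + 3) * (L + 5)) + 1) := by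
  induction cs generalizing s with
  | nil => exact Runs.skip.congr (by simp) (by simp)
  | cons c cs ih =>
    refine ((Runs.fill hk'.symm (by simp) hk ht).seq ((Runs.emit k c).seq
      ((Runs.fill hak ha hk (by simp [hk.symm, ht])).seq (ih (fun c hc => hcs c (by simp [hc]))
        (by simp [hk.symm, ht]))))).congr ?_ ?_
    · simp [hk'.symm, hak, row]
    · have := hcs c (by simp)
      simp [hk'.symm, hak]
      nlinarith

theorem Runs.emitSquare {a k : Stack} {z hd tl : Word} {cs : List Word} {L : ℕ} (hz : z.length ≤ L)
    (hhd : hd.length ≤ L) (htl : tl.length ≤ L) (hcs : ∀ c ∈ cs, c.length ≤ L) (hak : a ≠ k)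
    (ha : a ≠ .temp) (ha' : a ≠ .units') (hk : k ≠ .temp) (hk' : k ≠ .units') (ht : s .temp = [])
    (hu : s .units' = []) :
    Runs O (emitSquare a k z hd tl cs) s
      (update s k ((square z hd tl cs (s a).length).reverse ++ s k))
      (((s a).length + 1) * ((cs.length + 2) * (((s a).length + 3) * (L + 5)))) := by
  obtain ⟨n, hn⟩ : ∃ n, (s a).length = n := ⟨_, rfl⟩
  rw [hn]
  refine (Runs.seq (Runs.each (w := s a)
    (T := L + 1 + (cs.length * ((n + 3) * (L + 5)) + 1 + (L + 1 + 1)))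
    (fun d r => update (update (update s a r) k
      (((List.range d.length).flatMap fun i => line z hd tl cs i (n - 1 - i)).reverse ++ s k))
        .units' d.reverse)
    (fun d r => ?_) (fun d g r hw => ?_)) (Runs.move ha'.symm)).conv ?_ ?_ ?_
  · simp [ha', hak]
  · have hr : n - 1 - d.length = r.length := by
      have := congrArg List.length hw
      simp at this
      omega
    refine ((Runs.emit k hd).seq ((Runs.rows hz cs hcs hak ha hk hk' ?_).seq
      ((Runs.emit k tl).seq (Runs.push .units' g)))).congr ?_ ?_
    · simp [hk.symm, ha.symm, ht]
    · funext j
      simp only [Function.update_apply, List.length_append, List.length_singleton,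
        List.range_succ, List.flatMap_append, List.reverse_append]
      split_ifs <;> simp_all [line]
    · have : d.length + r.length + 1 = n := by
        rw [← hn, hw]
        simp
        omega
      simp [hk'.symm, ha'.symm, hak]
      have : cs.length * ((d.length + r.length + 3) * (L + 5)) ≤
          cs.length * ((n + 3) * (L + 5)) := by
        gcongr
        omega
      omega
  · funext j; simp only [Function.update_apply]; split_ifs <;> simp_all
  · funext j; simp only [Function.update_apply, square]; split_ifs <;> simp_all
  · simp [hn]
    nlinarith [Nat.zero_le (n * L), Nat.zero_le (n * n * L)]

end Rules

section

variable {F : Set (ℝ → ℝ)}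

/-! ### Weighted sums -/

/-- The sum `∑ j, w j * y j`. -/
noncomputable def dot (w : List ℚ) (y : List ℝ) : ℝ :=
  (List.zipWith (fun (c : ℚ) (t : ℝ) => (c : ℝ) * t) w y).sum

theorem Neuron.eval_eq (v : Neuron F) (y : List ℝ) :
    v.eval y = v.activation.1 (dot v.weights y + (v.bias : ℝ)) := rfl

@[simp] theorem dot_nil (y : List ℝ) : dot [] y = 0 := rfl

@[simp] theorem dot_nil_right (w : List ℚ) : dot w [] = 0 := by simp [dot]

@[simp] theorem dot_cons (c : ℚ) (w : List ℚ) (t : ℝ) (y : List ℝ) :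
    dot (c :: w) (t :: y) = c * t + dot w y := by simp [dot]

theorem dot_append {w w' : List ℚ} {y y' : List ℝ} (h : w.length = y.length) :
    dot (w ++ w') (y ++ y') = dot w y + dot w' y' := by
  induction w generalizing y with
  | nil =>
    cases y with
    | nil => simp
    | cons t y => simp at h
  | cons c w ih =>
    cases y with
    | nil => simp at h
    | cons t y => simp [ih (by simpa using h), add_assoc]

theorem dot_zeros (r : ℕ) (y : List ℝ) : dot (List.replicate r 0) y = 0 := by
  induction r generalizing y with
  | zero => simp
  | succ r ih => cases y <;> simp [List.replicate_succ, ih]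

/-- The row of length `i + 1 + r` with entry `c` at position `i`. -/
def unitRow (i r : ℕ) (c : ℚ) : List ℚ := List.replicate i 0 ++ c :: List.replicate r 0

@[simp] theorem length_unitRow (i r : ℕ) (c : ℚ) : (unitRow i r c).length = i + 1 + r := by
  simp [unitRow]
  omega

theorem dot_unitRow (i r : ℕ) (c : ℚ) (y : List ℝ) (h : i < y.length) :
    dot (unitRow i r c) y = c * y[i] := by
  induction i generalizing y with
  | zero =>
    cases y with
    | nil => simp at h
    | cons t y => simp [unitRow, dot_zeros]
  | succ i ih =>
    cases y with
    | nil => simp at h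
    | cons t y =>
      have := ih y (by simpa using h)
      simpa [unitRow, List.replicate_succ] using this

/-- `n` nodes with the identity as activation; the weights of the `i`-th one are the rows with
a single entry `c` at position `i`, for the `c` in `cs`. -/
def squareLayer (hid : id ∈ F) (cs : List ℚ) (n : ℕ) : Layer F :=
  (List.range n).map fun i => ⟨⟨id, hid⟩, 0, cs.flatMap (unitRow i (n - 1 - i))⟩

@[simp] theorem length_squareLayer (hid : id ∈ F) (cs : List ℚ) (n : ℕ) :
    (squareLayer hid cs n).length = n := by simp [squareLayer]

theorem length_weights_squareLayer {hid : id ∈ F} {cs : List ℚ} {n : ℕ} {v : Neuron F}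
    (hv : v ∈ squareLayer hid cs n) : v.weights.length = cs.length * n := by
  obtain ⟨i, hi, rfl⟩ := List.mem_map.1 hv
  have : i + 1 + (n - 1 - i) = n := by
    have := List.mem_range.1 hi
    omega
  simp [List.length_flatMap, this]

/-- The outputs of the nodes of a layer. -/
noncomputable def Layer.eval (L : Layer F) (y : List ℝ) : List ℝ := L.map fun v => v.eval y

theorem Layer.eval_append (L L' : Layer F) (y : List ℝ) :
    Layer.eval (L ++ L') y = Layer.eval L y ++ Layer.eval L' y := List.map_append

@[simp] theorem Layer.length_eval (L : Layer F) (y : List ℝ) : (L.eval y).length = L.length :=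
  List.length_map _

theorem eval_identity (hid : id ∈ F) {n : ℕ} {y : List ℝ} (hy : y.length = n) :
    Layer.eval (squareLayer hid [1] n) y = y := by
  refine List.ext_getElem (by simp [hy]) fun i h₁ h₂ => ?_
  simp [Layer.eval, squareLayer, Neuron.eval_eq, dot_unitRow _ _ _ _ h₂]

theorem eval_difference (hid : id ∈ F) {n : ℕ} {y y' : List ℝ} (hy : y.length = n)
    (hy' : y'.length = n) :
    Layer.eval (squareLayer hid [1, -1] n) (y ++ y') = List.zipWith (fun a b => a - b) y y' := by
  refine List.ext_getElem (by simp [hy, hy']) fun i h₁ h₂ => ?_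
  have hi : i < n := by simpa using h₁
  have : (unitRow i (n - 1 - i) 1).length = y.length := by
    simp
    omega
  simp [Layer.eval, squareLayer, Neuron.eval_eq, dot_append this,
    dot_unitRow _ _ _ _ (hi.trans_eq hy.symm), dot_unitRow _ _ _ _ (hi.trans_eq hy'.symm)]
  ring

theorem zipWith_sub_eq_zero {y y' : List ℝ} (h : y.length = y'.length) :
    (∀ t ∈ List.zipWith (fun a b => a - b) y y', t = 0) ↔ y = y' := by
  induction y generalizing y' with
  | nil =>
    cases y' with
    | nil => simp
    | cons t y' => simp at h
  | cons t y ih =>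
    cases y' with
    | nil => simp at h
    | cons t' y' => simp [ih (by simpa using h), sub_eq_zero]

/-! ### Deletion as setting to zero -/

/-- The list `y` with the entries at the positions in `s` replaced by `0`. -/
noncomputable def zeroAt (s : Finset ℕ) (y : List ℝ) : List ℝ :=
  y.mapIdx fun i t => if i ∈ s then 0 else t

@[simp] theorem length_zeroAt (s : Finset ℕ) (y : List ℝ) : (zeroAt s y).length = y.length := by
  simp [zeroAt]

theorem getElem?_zeroAt (s : Finset ℕ) (y : List ℝ) (i : ℕ) :
    (zeroAt s y)[i]? = y[i]?.map fun t => if i ∈ s then 0 else t := by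
  simp [zeroAt]

@[simp] theorem zeroAt_empty (y : List ℝ) : zeroAt ∅ y = y := by
  refine List.ext_getElem? fun i => ?_
  simp [getElem?_zeroAt]

@[simp] theorem removeAt_empty {α : Type} (l : List α) : removeAt ∅ l = l := by
  simp [removeAt]

theorem removeAt_map {α β : Type} (s : Finset ℕ) (f : α → β) (l : List α) :
    removeAt s (l.map f) = (removeAt s l).map f := by
  simp only [removeAt, List.zipIdx_map, List.filter_map, List.map_map]
  rfl

theorem dot_removeAt (s : Finset ℕ) (w : List ℚ) (y : List ℝ) :
    dot (removeAt s w) (removeAt s y) = dot w (zeroAt s y) := by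
  -- The offset `k` is needed for the induction, since positions in the tail are counted from `k +
  -- 1`.
  have key : ∀ (w : List ℚ) (y : List ℝ) (k : ℕ),
      dot (((w.zipIdx k).filter fun a => a.2 ∉ s).map Prod.fst)
        (((y.zipIdx k).filter fun a => a.2 ∉ s).map Prod.fst) =
      dot w (y.mapIdx fun i t => if i + k ∈ s then 0 else t) := by
    intro w
    induction w with
    | nil => simp
    | cons c w ih =>
      intro y k
      cases y with
      | nil => simp
      | cons t y =>
        have := ih y (k + 1)
        simp only [List.zipIdx_cons, List.mapIdx_cons, Nat.zero_add, dot_cons, Nat.add_assoc,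
          Nat.add_comm 1 k] at this ⊢
        by_cases hk : k ∈ s
        · simpa [hk] using this
        · simpa [hk] using this
  simpa [removeAt, zeroAt] using key w y 0

theorem eval_restrict (s : Finset ℕ) (v : Neuron F) (y : List ℝ) :
    (v.restrict s).eval (removeAt s y) = v.eval (zeroAt s y) := by
  simp [Neuron.eval_eq, Neuron.restrict, dot_removeAt]

/-- The output of the last layer if in each layer `k`, where layer `0` is the one before the first
of the given layers, the values at the positions in `s k` are replaced by `0`. -/
noncomputable def evalZero : (ℕ → Finset ℕ) → List (Layer F) → List ℝ → List ℝ
  | _, [], y => y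
  | s, L :: Ls, y => evalZero (fun k => s (k + 1)) Ls (L.eval (zeroAt (s 0) y))

/-- For the next layer, a missing summand and a summand `0` are the same. Unlike deletion, setting
to zero does not shift positions, so a fixed position can be followed through the layers. -/
theorem evalLayers_delete (out : Layer F) (Ls : List (Layer F)) (s : ℕ → Finset ℕ) (y : List ℝ) :
    evalLayers (Ls.mapIdx (fun k L => (removeAt (s (k + 1)) L).map (Neuron.restrict (s k))) ++
      [out.map (Neuron.restrict (s Ls.length))]) (removeAt (s 0) y) =
      evalZero s (Ls ++ [out]) y := by
  induction Ls generalizing s y with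
  | nil => simp [evalLayers, evalZero, eval_restrict, Layer.eval]
  | cons L Ls ih =>
    simp only [List.mapIdx_cons, List.cons_append, evalLayers, evalZero, List.map_map,
      Function.comp_def, eval_restrict, List.length_cons]
    rw [← ih, Layer.eval, removeAt_map]

theorem Network.eval_delete (N : Network F) (Y : Finset (ℕ × ℕ)) (x : List ℝ) :
    (N.delete Y).eval x = evalZero (deletedIn Y) N.layers x := by
  have := evalLayers_delete N.output N.hidden (deletedIn Y) x
  rwa [show removeAt (deletedIn Y 0) x = x from removeAt_empty x] at this

theorem evalLayers_append (Ls Ls' : List (Layer F)) (y : List ℝ) :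
    evalLayers (Ls ++ Ls') y = evalLayers Ls' (evalLayers Ls y) := by
  induction Ls generalizing y with
  | nil => rfl
  | cons L Ls ih => exact ih _

/-! ### Networks that carry all values along -/

/-- The number of nodes of the last layer. -/
def width : ℕ → List (Layer F) → ℕ
  | n, [] => n
  | _, L :: Ls => width L.length Ls

theorem wellFormed_append {n : ℕ} {Ls Ls' : List (Layer F)} :
    WellFormed n (Ls ++ Ls') ↔ WellFormed n Ls ∧ WellFormed (width n Ls) Ls' := by
  induction Ls generalizing n with
  | nil => simp [WellFormed, width]
  | cons L Ls ih => simp [WellFormed, width, ih, and_assoc]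

theorem width_append_singleton (n : ℕ) (Ls : List (Layer F)) (L : Layer F) :
    width n (Ls ++ [L]) = L.length := by
  induction Ls generalizing n with
  | nil => rfl
  | cons L Ls ih => exact ih _

/-- Every layer begins with copies of the nodes of the previous layer. -/
def Carry (hid : id ∈ F) : ℕ → List (Layer F) → Prop
  | _, [] => True
  | n, L :: Ls => (∃ E, L = squareLayer hid [1] n ++ E) ∧ Carry hid L.length Ls

theorem carry_append {hid : id ∈ F} {n : ℕ} {Ls Ls' : List (Layer F)} :
    Carry hid n (Ls ++ Ls') ↔ Carry hid n Ls ∧ Carry hid (width n Ls) Ls' := by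
  induction Ls generalizing n with
  | nil => simp [Carry, width]
  | cons L Ls ih => simp [Carry, width, ih, and_assoc]

/-- A zero at position `i` is copied by the identity node at position `i` of every later layer, and
further zeroing cannot undo it. At least one layer is needed: `evalZero` applies `s 0` only when a
layer reads the values. -/
theorem Carry.getElem?_evalZero {hid : id ∈ F} {n i : ℕ} {Ls : List (Layer F)}
    (h : Carry hid n Ls) {y : List ℝ} (hy : y.length = n) (s : ℕ → Finset ℕ)
    (hi : (zeroAt (s 0) y)[i]? = some 0) (hL : Ls ≠ []) : (evalZero s Ls y)[i]? = some 0 := by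
  induction Ls generalizing n y s with
  | nil => exact absurd rfl hL
  | cons L Ls ih =>
    obtain ⟨⟨E, rfl⟩, h⟩ := h
    have h₁ : (Layer.eval (squareLayer hid [1] n ++ E) (zeroAt (s 0) y))[i]? = some 0 := by
      rw [Layer.eval_append, eval_identity hid (by simpa using hy), List.getElem?_append_left, hi]
      exact (List.getElem?_eq_some_iff.1 hi).1
    rw [evalZero]
    rcases eq_or_ne Ls [] with rfl | hLs
    · exact h₁
    · refine ih h (by simp) _ ?_ hLs
      simp [getElem?_zeroAt, h₁]

/-- The layer with list index `k` has index `k + 1` for `s`, since `0` stands for the values before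
the first layer. The layer must not be the last one, whose outputs are never zeroed. -/
theorem Carry.getElem?_evalZero_of_mem {hid : id ∈ F} {n i k : ℕ} {Ls : List (Layer F)}
    (h : Carry hid n Ls) {L : Layer F} (hk : Ls[k]? = some L) (hi : i < L.length)
    (hk' : k + 1 < Ls.length) {y : List ℝ} (s : ℕ → Finset ℕ)
    (hs : i ∈ s (k + 1)) : (evalZero s Ls y)[i]? = some 0 := by
  induction k generalizing n Ls s y with
  | zero =>
    cases Ls with
    | nil => simp at hk
    | cons L' Ls =>
      obtain rfl : L' = L := by simpa using hk
      refine h.2.getElem?_evalZero (by simp) (fun k => s (k + 1)) ?_ ?_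
      · rw [getElem?_zeroAt, List.getElem?_eq_getElem (by simpa using hi)]
        simp only [Nat.zero_add] at hs ⊢
        simp [hs]
      · rintro rfl
        simp at hk'
  | succ k ih =>
    cases Ls with
    | nil => simp at hk
    | cons L' Ls => exact ih h.2 (by simpa using hk) (by simpa using hk') (fun k => s (k + 1)) hs

/-- The layers `Ls` carry all values along, and compute the functions `ys` on `ℝⁿ`, none of which
is zero. -/
structure Computes (hid : id ∈ F) (n : ℕ) (Ls : List (Layer F)) (ys : List (List ℝ → ℝ)) :
    Prop where
  wellFormed : WellFormed n Ls
  carry : Carry hid n Ls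
  width_eq : width n Ls = ys.length
  eval_eq : ∀ x : List ℝ, x.length = n → evalLayers Ls x = ys.map fun f => f x
  ne_zero : ∀ f ∈ ys, ∃ x : List ℝ, x.length = n ∧ f x ≠ 0

/-- The starting point of the construction: coordinate functions are nonzero, as the all-ones vector
shows. The default of `getD` plays no role on lists of length `n`. -/
theorem computes_nil (hid : id ∈ F) (n : ℕ) :
    Computes hid n [] ((List.range n).map fun i x => x.getD i 0) where
  wellFormed := trivial
  carry := trivial
  width_eq := by simp [width]
  eval_eq x hx := by
    refine List.ext_getElem (by simp [evalLayers, hx]) fun i h₁ h₂ => ?_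
    simp only [evalLayers] at h₁ ⊢
    simp [List.getElem?_eq_getElem h₁]
  ne_zero f hf := by
    obtain ⟨i, hi, rfl⟩ := List.mem_map.1 hf
    refine ⟨List.replicate n 1, by simp, ?_⟩
    simp [List.mem_range.1 hi]

/-- The next layer when `u` is the next node. -/
def nextLayer (hid : id ∈ F) (n : ℕ) (u : Neuron F) : Layer F := squareLayer hid [1] n ++ [u]

/-! ### One query decides whether a node computes the zero function -/

section Query

variable {hid : id ∈ F} {n : ℕ} {Ls : List (Layer F)} {ys : List (List ℝ → ℝ)} {u : Neuron F}

theorem Computes.wellFormed_next (h : Computes hid n Ls ys) (hu : u.weights.length = ys.length) :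
    WellFormed n (Ls ++ [nextLayer hid ys.length u]) := by
  refine wellFormed_append.2 ⟨h.wellFormed, fun v hv => ?_, trivial⟩
  rw [h.width_eq]
  rcases List.mem_append.1 hv with hv | hv
  · simpa using length_weights_squareLayer hv
  · rwa [List.mem_singleton.1 hv]

theorem Computes.carry_next (h : Computes hid n Ls ys) :
    Carry hid n (Ls ++ [nextLayer hid ys.length u]) :=
  carry_append.2 ⟨h.carry, ⟨[u], by rw [h.width_eq]; rfl⟩, trivial⟩

theorem Computes.eval_next (h : Computes hid n Ls ys) {x : List ℝ} (hx : x.length = n) :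
    evalLayers (Ls ++ [nextLayer hid ys.length u]) x =
      (ys ++ [fun x => u.eval (ys.map fun f => f x)]).map fun f => f x := by
  rw [evalLayers_append, h.eval_eq x hx]
  change Layer.eval _ _ = _
  rw [nextLayer, Layer.eval_append, eval_identity hid (by simp)]
  simp [Layer.eval]

theorem Computes.next (h : Computes hid n Ls ys) (hu : u.weights.length = ys.length)
    (hne : ∃ x : List ℝ, x.length = n ∧ u.eval (ys.map fun f => f x) ≠ 0) :
    Computes hid n (Ls ++ [nextLayer hid ys.length u])
      (ys ++ [fun x => u.eval (ys.map fun f => f x)]) where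
  wellFormed := h.wellFormed_next hu
  carry := h.carry_next
  width_eq := by simp [width_append_singleton, nextLayer]
  eval_eq x hx := h.eval_next hx
  ne_zero f hf := by
    rcases List.mem_append.1 hf with hf | hf
    · exact h.ne_zero f hf
    · rwa [List.mem_singleton.1 hf]

/-- The network that is used to ask whether the node `u` computes the zero function. -/
def Computes.network (h : Computes hid n Ls ys) (hu : u.weights.length = ys.length) :
    Network F where
  inputs := n
  hidden := Ls ++ [nextLayer hid ys.length u]
  output := squareLayer hid [1] (ys.length + 1)
  wellFormed := by
    refine wellFormed_append.2 ⟨h.wellFormed_next hu, fun v hv => ?_, trivial⟩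
    rw [width_append_singleton]
    simpa [nextLayer] using length_weights_squareLayer hv

theorem Computes.eval_network (h : Computes hid n Ls ys) (hu : u.weights.length = ys.length)
    {x : List ℝ} (hx : x.length = n) : (h.network hu).eval x =
      (ys ++ [fun x => u.eval (ys.map fun f => f x)]).map fun f => f x := by
  change evalLayers ((Ls ++ [nextLayer hid ys.length u]) ++ [squareLayer hid [1] _]) x = _
  rw [evalLayers_append, h.eval_next hx]
  exact eval_identity hid (by simp)

/-- A zero node can be deleted without effect. Conversely, deleting any node at position `i` forces
the `i`-th output to be zero, which is visible once all carried functions, including the new one,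
are nonzero. -/
theorem Computes.allNecessary_network (h : Computes hid n Ls ys)
    (hu : u.weights.length = ys.length) : (h.network hu).AllNecessary ↔
      ∃ x : List ℝ, x.length = n ∧ u.eval (ys.map fun f => f x) ≠ 0 := by
  constructor
  · intro hN
    by_contra! hz
    -- The witness is the new node alone: it is the last node of the last hidden layer.
    refine hN {(Ls.length, ys.length)} (by simp) ?_ ⟨rfl, ?_, fun x hx => ?_⟩
    · rintro p hp
      rw [Finset.mem_singleton.1 hp]
      exact ⟨nextLayer hid ys.length u, by simp [Computes.network], by simp [nextLayer]⟩
    · simp [Computes.network, Network.delete]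
    · have hx : x.length = n := hx
      rw [Network.eval_delete]
      have hd : ∀ k, k ≠ Ls.length + 1 → deletedIn {(Ls.length, ys.length)} k = ∅ := by
        intro k hk
        cases k with
        | zero => rfl
        | succ k =>
          have : ¬ Ls.length = k := by omega
          simp [deletedIn, Finset.filter_singleton, this]
      have hd' : deletedIn {(Ls.length, ys.length)} (Ls.length + 1) = {ys.length} := by
        simp [deletedIn, Finset.filter_singleton]
      -- Zeroing only in the last hidden layer is harmless if the zeroed values are already zero
      -- there.
      have key : ∀ (Ls' : List (Layer F)) (y : List ℝ) (s : ℕ → Finset ℕ),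
          (∀ k, k ≠ Ls'.length + 1 → s k = ∅) → s (Ls'.length + 1) = {ys.length} →
          ∀ L out : Layer F, zeroAt {ys.length} (evalLayers (Ls' ++ [L]) y) =
            evalLayers (Ls' ++ [L]) y →
          evalZero s (Ls' ++ [L] ++ [out]) y = evalLayers (Ls' ++ [L] ++ [out]) y := by
        intro Ls'
        induction Ls' with
        | nil =>
          intro y s hs hs' L out hL
          have h1 : s 1 = {ys.length} := hs'
          simp only [List.nil_append, evalLayers] at hL
          simp [evalZero, evalLayers, hs 0 (by simp), h1, Layer.eval, hL]
        | cons L' Ls' ih =>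
          intro y s hs hs' L out hL
          simp only [List.cons_append, evalZero, evalLayers, hs 0 (by simp), zeroAt_empty]
          exact ih _ (fun k => s (k + 1)) (fun k hk => hs _ (by simpa using hk)) hs' L out hL
      refine (key Ls x _ hd hd' _ _ ?_).symm
      rw [h.eval_next hx]
      refine List.ext_getElem? fun i => ?_
      rw [getElem?_zeroAt]
      by_cases hi : i = ys.length
      · subst hi
        simp [hz x hx]
      · simp [hi]
  · rintro hne Y ⟨⟨k, i⟩, hY⟩ hhid ⟨-, -, hsame⟩
    obtain ⟨L, hk, hi⟩ := hhid _ hY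
    -- Carrying layers never shrink, so a position in some hidden layer is also a position in the
    -- last one, and hence among the outputs.
    have hwidth : ∀ {n k : ℕ} {Ls : List (Layer F)} {L : Layer F}, Carry hid n Ls →
        Ls[k]? = some L → L.length ≤ width n Ls ∧ k < Ls.length := by
      intro n k Ls L hC hk
      refine ⟨?_, (List.getElem?_eq_some_iff.1 hk).1⟩
      have mono : ∀ {n : ℕ} {Ls : List (Layer F)}, Carry hid n Ls → n ≤ width n Ls := by
        intro n Ls hC
        induction Ls generalizing n with
        | nil => exact le_rfl
        | cons L Ls ih =>
          obtain ⟨⟨E, rfl⟩, hC⟩ := hC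
          exact le_trans (by simp) (ih hC)
      induction Ls generalizing n k with
      | nil => simp at hk
      | cons L' Ls ih =>
        cases k with
        | zero =>
          obtain rfl : L' = L := by simpa using hk
          exact mono hC.2
        | succ k => exact ih hC.2 (by simpa using hk)
    have hk₁ := hwidth (h.carry_next (u := u)) hk
    have hi' : i < (ys ++ [fun x => u.eval (ys.map fun f => f x)]).length := by
      have := hk₁.1
      rw [width_append_singleton] at this
      simpa [nextLayer] using hi.trans_le this
    -- An input at which the `i`-th output of the full network is nonzero, whereas the deletion
    -- forces this output to be `0`.
    obtain ⟨x, hx, hfx⟩ := (h.next hu hne).ne_zero _ (List.getElem_mem hi')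
    have hC : Carry hid n (h.network hu).layers := by
      refine carry_append.2 ⟨h.carry_next, ⟨[], ?_⟩, trivial⟩
      simp [Computes.network, width_append_singleton, nextLayer]
    have h₁ := hsame x hx
    have h₂ := hC.getElem?_evalZero_of_mem (k := k) (i := i) (L := L) (y := x) ?_ hi ?_
      (deletedIn Y) ?_
    · rw [← Network.eval_delete, ← h₁, h.eval_network hu hx, List.getElem?_map,
        List.getElem?_eq_getElem hi'] at h₂
      exact hfx (by simpa using h₂)
    · change ((h.network hu).hidden ++ _)[k]? = _
      rw [List.getElem?_append_left (by exact hk₁.2)]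
      exact hk
    · change k + 1 < ((h.network hu).hidden ++ [_]).length
      rw [List.length_append]
      exact Nat.add_lt_add_right hk₁.2 1
    · exact Finset.mem_image.2 ⟨(k, i), Finset.mem_filter.2 ⟨hY, rfl⟩, rfl⟩

end Query

end

section

/-! ### Stores with named stacks -/

/-- The contents of the stacks, by name. -/
structure Stacks where
  input : Word := []
  query : Word := []
  layer : Word := []
  out : Word := []
  pre : Word := []
  tags : Word := []
  tags' : Word := []
  units : Word := []
  units' : Word := []
  temp : Word := []
  count₁ : Word := []
  count₂ : Word := []
  count₃ : Word := []
  fail : Word := []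

/-- The store with the given stacks. -/
def Stacks.store (S : Stacks) : Store
  | .input => S.input
  | .query => S.query
  | .layer => S.layer
  | .out => S.out
  | .pre => S.pre
  | .tags => S.tags
  | .tags' => S.tags'
  | .units => S.units
  | .units' => S.units'
  | .temp => S.temp
  | .count₁ => S.count₁
  | .count₂ => S.count₂
  | .count₃ => S.count₃
  | .fail => S.fail

section

variable (S : Stacks) (w : Word)

@[simp] theorem Stacks.store_input : S.store .input = S.input := rfl

@[simp] theorem Stacks.store_query : S.store .query = S.query := rfl

@[simp] theorem Stacks.store_layer : S.store .layer = S.layer := rfl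

@[simp] theorem Stacks.store_out : S.store .out = S.out := rfl

@[simp] theorem Stacks.store_pre : S.store .pre = S.pre := rfl

@[simp] theorem Stacks.store_tags : S.store .tags = S.tags := rfl

@[simp] theorem Stacks.store_tags' : S.store .tags' = S.tags' := rfl

@[simp] theorem Stacks.store_units : S.store .units = S.units := rfl

@[simp] theorem Stacks.store_units' : S.store .units' = S.units' := rfl

@[simp] theorem Stacks.store_temp : S.store .temp = S.temp := rfl

@[simp] theorem Stacks.store_count₁ : S.store .count₁ = S.count₁ := rfl

@[simp] theorem Stacks.store_count₂ : S.store .count₂ = S.count₂ := rfl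

@[simp] theorem Stacks.store_count₃ : S.store .count₃ = S.count₃ := rfl

@[simp] theorem Stacks.store_fail : S.store .fail = S.fail := rfl

@[simp] theorem Stacks.update_input :
    update S.store .input w = { S with input := w }.store := by
  funext j; cases j <;> rfl

@[simp] theorem Stacks.update_query :
    update S.store .query w = { S with query := w }.store := by
  funext j; cases j <;> rfl

@[simp] theorem Stacks.update_layer :
    update S.store .layer w = { S with layer := w }.store := by
  funext j; cases j <;> rfl

@[simp] theorem Stacks.update_out :
    update S.store .out w = { S with out := w }.store := by
  funext j; cases j <;> rfl

@[simp] theorem Stacks.update_pre :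
    update S.store .pre w = { S with pre := w }.store := by
  funext j; cases j <;> rfl

@[simp] theorem Stacks.update_tags :
    update S.store .tags w = { S with tags := w }.store := by
  funext j; cases j <;> rfl

@[simp] theorem Stacks.update_tags' :
    update S.store .tags' w = { S with tags' := w }.store := by
  funext j; cases j <;> rfl

@[simp] theorem Stacks.update_units :
    update S.store .units w = { S with units := w }.store := by
  funext j; cases j <;> rfl

@[simp] theorem Stacks.update_units' :
    update S.store .units' w = { S with units' := w }.store := by
  funext j; cases j <;> rfl

@[simp] theorem Stacks.update_temp :
    update S.store .temp w = { S with temp := w }.store := by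
  funext j; cases j <;> rfl

@[simp] theorem Stacks.update_count₁ :
    update S.store .count₁ w = { S with count₁ := w }.store := by
  funext j; cases j <;> rfl

@[simp] theorem Stacks.update_count₂ :
    update S.store .count₂ w = { S with count₂ := w }.store := by
  funext j; cases j <;> rfl

@[simp] theorem Stacks.update_count₃ :
    update S.store .count₃ w = { S with count₃ := w }.store := by
  funext j; cases j <;> rfl

@[simp] theorem Stacks.update_fail :
    update S.store .fail w = { S with fail := w }.store := by
  funext j; cases j <;> rfl

end

theorem inputStore_eq (w : List Symbol) :
    inputStore w = ({ input := w.map Sum.inl } : Stacks).store := by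
  funext j; cases j <;> rfl

/-! ### Subroutines -/

variable {O : Set (List Symbol)}

/-- No stack can grow by more than the number of steps. -/
theorem Exec.length_le {p : Prog} {s s' : Store} {t : ℕ} (h : Exec O p s s' t) (k : Stack) :
    (s' k).length ≤ (s k).length + t := by
  have pop : ∀ (s : Store) (j : Stack), (update s j (s j).tail k).length ≤ (s k).length := by
    intro s j
    rw [Function.update_apply]
    split_ifs with hj
    · subst hj; simp
    · exact le_rfl
  induction h with
  | skip s => omega
  | push j g s =>
    rw [Function.update_apply]
    split_ifs with hj
    · subst hj; simp
    · omega
  | seq _ _ ih₁ ih₂ => omega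
  | @leave j _ _ s _ _ _ _ ih => have := pop s j; omega
  | @next j _ _ s _ _ _ _ _ _ _ ih₁ ih₂ => have := pop s j; omega
  | ask s =>
    rw [Function.update_apply]
    split_ifs <;> simp

theorem Runs.length_le {p : Prog} {s s' : Store} {T : ℕ} (h : Runs O p s s' T) (k : Stack) :
    (s' k).length ≤ (s k).length + T :=
  let ⟨_, ht, h⟩ := h
  (h.length_le k).trans (Nat.add_le_add_left ht _)

/-- The words that end at the first occurrence of `endWord`. -/
def IsWord (e : Word) : Prop := ∃ w, e = w ++ [.inl endWord] ∧ .inl endWord ∉ w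

theorem Runs.readWord_push {s : Store} {k : Stack} {e r : Word} (hk : k ≠ .input) (he : IsWord e)
    (hs : s .input = e ++ r) : Runs O (NeuralNet.readWord (.push k)) s
      (update (update s .input r) k (e.reverse ++ s k)) (2 * e.length) := by
  obtain ⟨w, rfl, hw⟩ := he
  refine (Runs.readWord (r := r) (T := 1)
    (fun d r => update (update s .input r) k (d.reverse ++ s k))
    (fun d r => ?_) hw (fun d g v => ?_)).conv ?_ rfl ?_
  · simp [hk.symm]
  · refine (Runs.push k g).congr ?_ le_rfl
    funext j; simp only [Function.update_apply]; split_ifs <;> simp_all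
  · funext j; simp only [Function.update_apply]; split_ifs <;> simp_all
  · simp
    omega

theorem Runs.readWord_skip {s : Store} {e r : Word} (he : IsWord e)
    (hs : s .input = e ++ r) : Runs O (NeuralNet.readWord fun _ => .skip) s
      (update s .input r) (2 * e.length) := by
  obtain ⟨w, rfl, hw⟩ := he
  refine (Runs.readWord (r := r) (T := 1) (fun _ r => update s .input r)
    (fun d r => ?_) hw (fun d g v => ?_)).conv ?_ rfl ?_
  · simp
  · exact Runs.skip.congr (by simp) le_rfl
  · funext j; simp only [Function.update_apply]; split_ifs <;> simp_all
  · simp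
    omega

/-- Empty the stack `k`. -/
def clear (k : Stack) : Prog := each k fun _ => .skip

theorem Runs.clear {s : Store} (k : Stack) :
    Runs O (clear k) s (update s k []) (2 * (s k).length + 2) := by
  refine (Runs.each (w := s k) (T := 1) (fun _ r => update s k r) (fun d r => ?_)
    (fun d g r _ => ?_)).conv (by simp) rfl (by omega)
  · simp
  · exact Runs.skip.congr (by simp) le_rfl

/-- The mark used for counting. -/
def mark : Cell := .inl slash

/-- `n` marks. -/
def marks (n : ℕ) : Word := List.replicate n mark

@[simp] theorem length_marks (n : ℕ) : (marks n).length = n := List.length_replicate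

theorem marks_succ (n : ℕ) : marks (n + 1) = mark :: marks n := rfl

/-- Apply `f` to all tags. -/
def relabel (f : Tag → Tag) : Prog :=
  each .tags (fun g => .push .tags' (g.map id f)) ;; move .tags' .tags

theorem Runs.relabel (f : Tag → Tag) (S : Stacks) (ts : List Tag) (ht : S.tags = ts.map .inr)
    (ht' : S.tags' = []) : Runs O (relabel f) S.store
      { S with tags := (ts.map f).map .inr }.store (5 * ts.length + 4) := by
  refine ((Runs.each (w := S.tags) (T := 1)
    (fun d r => { S with tags := r, tags' := (d.map (Sum.map id f)).reverse }.store)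
    (fun d r => rfl) (fun d g r _ => ?_)).seq (Runs.move (by simp))).conv ?_ ?_ ?_
  · exact (Runs.push _ _).congr (by simp) le_rfl
  · cases S; simp_all
  · have : Sum.map id f ∘ (Sum.inr : Tag → Cell) = Sum.inr ∘ f := rfl
    cases S; simp_all
  · simp [ht]
    omega

/-- Push a mark to `k` for each tag that satisfies `p`. -/
def countTags (p : Tag → Bool) (k : Stack) : Prog :=
  each .tags (fun g => .push .tags' g ;;
    if g.elim (fun _ => false) p then .push k mark else .skip) ;; move .tags' .tags

theorem Runs.countTags (p : Tag → Bool) {k : Stack} (hk : k ≠ .tags) (hk' : k ≠ .tags')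
    (S : Stacks) (ts : List Tag) (ht : S.tags = ts.map .inr)
    (ht' : S.tags' = []) : Runs O (countTags p k) S.store
      (update S.store k (marks (ts.filter p).length ++ S.store k)) (5 * ts.length + 4) := by
  refine ((Runs.each (w := S.tags) (T := 2)
    (fun d r => update { S with tags := r, tags' := d.reverse }.store k
      (marks (d.filter fun g => g.elim (fun _ => false) p).length ++ S.store k))
    (fun d r => ?_) (fun d g r _ => ?_)).seq (Runs.move (by simp))).conv ?_ ?_ ?_
  · simp [hk.symm]
  · split_ifs with hg
    · refine ((Runs.push _ _).seq (Runs.push _ _)).congr ?_ le_rfl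
      funext j
      by_cases h : j = k
      · subst h
        simp [hk, hk', hg, marks_succ, List.filter_append]
      · cases j <;> simp_all
    · refine ((Runs.push _ _).seq Runs.skip).congr ?_ le_rfl
      funext j
      by_cases h : j = k
      · subst h
        simp [hk, hk', hg, List.filter_append]
      · cases j <;> simp_all
  · funext j
    by_cases h : j = k
    · subst h
      simp [marks]
    · cases j <;> simp_all
  · have : (S.tags.filter fun g => g.elim (fun _ => false) p).length = (ts.filter p).length := by
      rw [ht, List.filter_map, List.length_map]
      rfl
    funext j
    by_cases h : j = k
    · subst h
      simp [hk, hk', this]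
    · cases j <;> simp_all [hk'.symm]
  · simp [hk'.symm, ht]
    omega

/-- Push marks to `fail` unless the stacks `count₁` and `count₂`, which are emptied, have the same
height. -/
def compareCounts : Prog :=
  each .count₁ (fun _ => pop .count₂ fun o => o.elim (.push .fail mark) fun _ => .skip) ;;
    each .count₂ fun _ => .push .fail mark

/-- With truncated subtraction `a - b + (b - a)` is the distance of `a` and `b`: the first loop
records the excess of `count₁`, the second that of `count₂`. -/
theorem Runs.compareCounts (S : Stacks) (a b : ℕ) (h₁ : S.count₁ = marks a)
    (h₂ : S.count₂ = marks b) (hf : S.fail = []) : Runs O compareCounts S.store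
      { S with count₁ := [], count₂ := [], fail := marks (a - b + (b - a)) }.store
      (3 * a + 2 * b + 4) := by
  have h : Runs O (NeuralNet.each .count₁ fun _ =>
      NeuralNet.pop .count₂ fun o => o.elim (.push .fail mark) fun _ => .skip) S.store
      { S with count₁ := [], count₂ := marks (b - a), fail := marks (a - b) }.store
      (a * (2 + 1) + 2) := by
    refine (Runs.each (w := marks a) (T := 2) (fun d r =>
      { S with count₁ := r, count₂ := marks (b - d.length), fail := marks (d.length - b) }.store)
      (fun d r => rfl) (fun d g r _ => ?_)).conv ?_ ?_ ?_
    · rcases Nat.lt_or_ge d.length b with hd | hd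
      · have h₁ : b - d.length = b - (d.length + 1) + 1 := by omega
        have h₂ : d.length + 1 - b = d.length - b := by omega
        refine (Runs.pop (T := 1) ?_).mono le_rfl
        simp [h₁, h₂, marks_succ]
        exact Runs.skip
      · have h₁ : b - d.length = 0 := by omega
        have h₁' : b - (d.length + 1) = 0 := by omega
        have h₂ : d.length + 1 - b = d.length - b + 1 := by omega
        refine (Runs.pop (T := 1) ?_).mono le_rfl
        simp only [Stacks.store_count₂, Stacks.update_count₁, h₁, h₁', h₂, marks_succ,
          List.length_append, List.length_singleton]
        exact (Runs.push _ _).congr (by simp [marks]) le_rfl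
    · cases S; simp_all
      rfl
    · simp
    · simp
  refine (h.seq (Runs.each (w := marks (b - a)) (T := 1) (fun d r =>
    { S with count₁ := [], count₂ := r, fail := marks (a - b + d.length) }.store)
    (fun d r => rfl) (fun d g r _ => ?_))).congr ?_ ?_
  · exact (Runs.push _ _).congr (by simp [marks_succ, ← Nat.add_assoc]) le_rfl
  · simp
  · simp
    omega

end

section

variable {F : Set (ℝ → ℝ)} {O : Set (List Symbol)}

/-! ### Tagged values -/

/-- A value that has been processed: its tag, and the value as a function of the input. -/
abbrev Value : Type := Tag × (List ℝ → ℝ)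

/-- The functions that are computed by the current layers. -/
def kept (V : List Value) : List (List ℝ → ℝ) := (V.filter fun p => p.1.kept).map Prod.snd

/-- Is this one of the values that are used by the current layer? -/
def Tag.isPrev (t : Tag) : Bool := t.status = .prev

/-- The functions on which the nodes of the current layer depend. -/
def prevs (V : List Value) : List (List ℝ → ℝ) := (V.filter fun p => p.1.isPrev).map Prod.snd

/-- The weights from all kept values, when `w` are the weights from the values of the previous
layer. -/
def expand : List Tag → List ℚ → List ℚ
  | [], _ => []
  | t :: ts, w =>
    if t.isPrev then
      -- The default `0` is not reached when there is exactly one weight for each value of the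
      -- previous layer.
      if t.kept then w.headD 0 :: expand ts w.tail else expand ts w.tail
    else if t.kept then 0 :: expand ts w else expand ts w

@[simp] theorem kept_cons (p : Value) (V : List Value) :
    kept (p :: V) = if p.1.kept then p.2 :: kept V else kept V := by
  by_cases h : p.1.kept <;> simp [kept, h]

@[simp] theorem prevs_cons (p : Value) (V : List Value) :
    prevs (p :: V) = if p.1.isPrev then p.2 :: prevs V else prevs V := by
  by_cases h : p.1.isPrev <;> simp [prevs, h]

@[simp] theorem kept_append (V W : List Value) : kept (V ++ W) = kept V ++ kept W := by
  simp [kept]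

@[simp] theorem prevs_append (V W : List Value) : prevs (V ++ W) = prevs V ++ prevs W := by
  simp [prevs]

theorem length_kept_le (V : List Value) : (kept V).length ≤ V.length := by
  simpa [kept] using List.length_filter_le _ V

theorem length_expand (V : List Value) (w : List ℚ) :
    (expand (V.map Prod.fst) w).length = (kept V).length := by
  induction V generalizing w with
  | nil => rfl
  | cons p V ih =>
    simp only [List.map_cons, expand, kept_cons]
    split_ifs <;> simp [ih]

/-- Only zero terms are inserted or omitted: kept values outside the previous layer get weight `0`,
and dropped values are themselves `0` at `x`. -/
theorem dot_expand (V : List Value) (w : List ℚ) (x : List ℝ)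
    (hV : ∀ p ∈ V, p.1.kept = false → p.2 x = 0) (hw : w.length = (prevs V).length) :
    dot (expand (V.map Prod.fst) w) ((kept V).map fun f => f x) =
      dot w ((prevs V).map fun f => f x) := by
  induction V generalizing w with
  | nil => simp [expand, kept, prevs]
  | cons p V ih =>
    have ih := fun w => ih w fun q hq => hV q (by simp [hq])
    simp only [List.map_cons, expand, kept_cons, prevs_cons] at hw ⊢
    by_cases hp : p.1.isPrev
    · simp only [hp, if_true] at hw ⊢
      cases w with
      | nil => simp at hw
      | cons c w =>
        have hw : w.length = (prevs V).length := by simpa using hw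
        by_cases hk : p.1.kept
        · simp [hk, ih w hw]
        · simp [hk, ih w hw, hV p (by simp) (by simpa using hk)]
    · simp only [hp, Bool.false_eq_true, if_false] at hw ⊢
      by_cases hk : p.1.kept
      · simp [hk, ih w hw]
      · simp [hk, ih w hw]

/-- The kept values are computed by `Ls`, and the others are zero. -/
structure Valid (hid : id ∈ F) (n : ℕ) (Ls : List (Layer F)) (V : List Value) : Prop where
  computes : Computes hid n Ls (kept V)
  dropped : ∀ p ∈ V, p.1.kept = false → ∀ x : List ℝ, x.length = n → p.2 x = 0

/-- The value of the function at a node of the current layer. -/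
noncomputable def nodeFun (V : List Value) (v : Neuron F) (x : List ℝ) : ℝ :=
  v.eval ((prevs V).map fun f => f x)

open Classical in
/-- The tagged value of a node of the current layer. -/
noncomputable def nodeValue (n : ℕ) (V : List Value) (v : Neuron F) : Value :=
  (⟨false, false, .cur, decide (∃ x : List ℝ, x.length = n ∧ nodeFun V v x ≠ 0)⟩, nodeFun V v)

/-- The node `v` with weights from all kept values. -/
def Neuron.expand (v : Neuron F) (ts : List Tag) : Neuron F :=
  { v with weights := NeuralNet.expand ts v.weights }

section

variable {hid : id ∈ F} {n : ℕ} {Ls : List (Layer F)} {V : List Value} {v : Neuron F}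

theorem Valid.eval_expand (h : Valid hid n Ls V) (hv : v.weights.length = (prevs V).length)
    {x : List ℝ} (hx : x.length = n) :
    (v.expand (V.map Prod.fst)).eval ((kept V).map fun f => f x) = nodeFun V v x := by
  rw [nodeFun, Neuron.eval_eq, Neuron.eval_eq]
  exact congrArg (fun t => v.activation.1 (t + (v.bias : ℝ)))
    (dot_expand V v.weights x (fun p hp hk => h.dropped p hp hk x hx) hv)

-- The invariant survives either answer: a nonzero value is appended through one more carrying
-- layer, a zero value is recorded as dropped and the layers stay as they are.
open Classical in
theorem Valid.next (h : Valid hid n Ls V) (hv : v.weights.length = (prevs V).length) :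
    Valid hid n (if (nodeValue n V v).1.kept then
      Ls ++ [nextLayer hid (kept V).length (v.expand (V.map Prod.fst))] else Ls)
      (V ++ [nodeValue n V v]) := by
  by_cases hne : ∃ x : List ℝ, x.length = n ∧ nodeFun V v x ≠ 0
  · have hk : (nodeValue n V v).1.kept = true := decide_eq_true hne
    have := h.computes.next (u := v.expand (V.map Prod.fst)) (length_expand V v.weights) (by
      obtain ⟨x, hx, hxne⟩ := hne
      exact ⟨x, hx, by rwa [h.eval_expand hv hx]⟩)
    rw [if_pos hk]
    refine ⟨⟨this.wellFormed, this.carry, ?_, fun x hx => ?_, fun f hf => ?_⟩, fun p hp hpk => ?_⟩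
    · simpa [hk, kept] using this.width_eq
    · rw [this.eval_eq x hx, kept_append, List.map_append, List.map_append]
      simp only [List.map_cons, List.map_nil, h.eval_expand hv hx, kept_cons, hk, if_true]
      rfl
    · rw [kept_append, List.mem_append] at hf
      rcases hf with hf | hf
      · exact h.computes.ne_zero f hf
      · have : f = nodeFun V v := by
          simp only [kept_cons, hk, if_true] at hf
          simpa [kept, nodeValue] using hf
        rwa [this]
    · rcases List.mem_append.1 hp with hp | hp
      · exact h.dropped p hp hpk
      · rw [List.mem_singleton.1 hp, hk] at hpk
        cases hpk
  · have hk : (nodeValue n V v).1.kept = false := decide_eq_false hne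
    rw [if_neg (by simp [hk])]
    refine ⟨by simpa [hk, kept] using h.computes, fun p hp hpk => ?_⟩
    rcases List.mem_append.1 hp with hp | hp
    · exact h.dropped p hp hpk
    · rw [List.mem_singleton.1 hp]
      push Not at hne
      exact hne

/-- The network that is used to ask whether the node `v` computes the zero function. -/
noncomputable def Valid.network (h : Valid hid n Ls V) (v : Neuron F) : Network F :=
  h.computes.network (u := v.expand (V.map Prod.fst)) (length_expand V v.weights)

-- By `eval_expand`, the node over the kept values computes the same function as the original node,
-- so the answer to the query is the `kept` bit of its tag.
open Classical in
theorem Valid.allNecessary_network (h : Valid hid n Ls V)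
    (hv : v.weights.length = (prevs V).length) :
    (h.network v).AllNecessary ↔ (nodeValue n V v).1.kept = true := by
  refine (h.computes.allNecessary_network (length_expand V v.weights)).trans ?_
  rw [nodeValue, decide_eq_true_iff]
  refine exists_congr fun x => and_congr_right fun hx => ?_
  rw [h.eval_expand hv hx]

end

/-! ### Codes on the stacks -/

/-- A word over the input alphabet as a word over the stack alphabet. -/
def lift (w : List Symbol) : Word := w.map Sum.inl

@[simp] theorem lift_append (w w' : List Symbol) : lift (w ++ w') = lift w ++ lift w' :=
  List.map_append

@[simp] theorem lift_nil : lift [] = [] := rfl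

@[simp] theorem lift_cons (a : Symbol) (w : List Symbol) : lift (a :: w) = .inl a :: lift w := rfl

@[simp] theorem length_lift (w : List Symbol) : (lift w).length = w.length := List.length_map _

theorem lift_flatMap {α : Type} (l : List α) (f : α → List Symbol) :
    lift (l.flatMap f) = l.flatMap fun a => lift (f a) := by
  simp [lift, List.map_flatMap]

theorem isWord_bits (l : List Bool) : IsWord (lift (encodeBits endWord l)) :=
  ⟨lift (l.map bit), by simp [encodeBits], by simp [lift]⟩

/-- Numerator and denominator are separated by `slash`, so `endWord` occurs only at the end of the
code. -/
theorem isWord_rat (q : ℚ) : IsWord (lift (encodeRat q)) :=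
  ⟨lift (bit (decide (q.num < 0)) :: (encodeBits slash q.num.natAbs.bits ++ q.den.bits.map bit)),
    by simp [encodeRat, encodeBits], by simp [lift, encodeBits]⟩

/-- The code of a rational number on a stack. -/
def ratWord (q : ℚ) : Word := lift (encodeRat q)

/-- The beginning of the code of a node with the identity as activation and bias `0`. -/
def idWord (hid : id ∈ F) (name : F ↪ List Bool) : Word :=
  lift (encodeBits endWord (name ⟨id, hid⟩) ++ encodeRat 0)

theorem lift_unitRow (i r : ℕ) (c : ℚ) :
    lift ((unitRow i r c).flatMap encodeRat) = row (ratWord 0) i r (ratWord c) := by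
  have : ∀ k, lift ((List.replicate k (0 : ℚ)).flatMap encodeRat) = rep k (ratWord 0) := by
    intro k
    rw [lift_flatMap, List.flatMap_replicate]
    rfl
  simp [unitRow, row, this, ratWord]

/-- This identifies the code of a carrying or difference layer with a square array that `emitSquare`
can write from a unary counter. -/
theorem lift_squareLayer (hid : id ∈ F) (name : F ↪ List Bool) (cs : List ℚ) (n : ℕ) :
    lift ((squareLayer hid cs n).flatMap (encodeNeuron name)) =
      square (ratWord 0) (idWord hid name) [.inl endNeuron] (cs.map ratWord) n := by
  rw [lift_flatMap, squareLayer, List.flatMap_map, square]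
  congr 1
  funext i
  simp only [encodeNeuron, lift_append, line, idWord, List.append_assoc, List.flatMap_assoc]
  congr 3
  rw [lift_flatMap, List.flatMap_map]
  congr 1
  funext c
  exact lift_unitRow _ _ _

/-- The tags of some values as a word. -/
def tagWord (V : List Value) : Word := (V.map Prod.fst).map Sum.inr

@[simp] theorem tagWord_nil : tagWord [] = [] := rfl

@[simp] theorem tagWord_cons (p : Value) (V : List Value) :
    tagWord (p :: V) = .inr p.1 :: tagWord V := rfl

@[simp] theorem tagWord_append (V W : List Value) :
    tagWord (V ++ W) = tagWord V ++ tagWord W := by simp [tagWord]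

@[simp] theorem length_tagWord (V : List Value) : (tagWord V).length = V.length := by
  simp [tagWord]

/-! ### Reading a node -/

/-- Copy, skip or insert the weight from a value. -/
def weightStep : Cell → Prog
  | .inl _ => .skip
  | .inr t =>
    if t.isPrev then
      if t.kept then readWord (.push .layer) else readWord fun _ => .skip
    else if t.kept then emit .layer (ratWord 0) else .skip

/-- Tags and weights are scanned in parallel: a value of the previous layer consumes one weight from
the input, which is copied or discarded; any other value consumes none, and gets weight `0` if it is
kept. This is the recursion of `expand`. -/
theorem runs_weights (B : ℕ) (hB : (ratWord 0).length ≤ B) (V : List Value) :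
    ∀ (S : Stacks) (w : List ℚ) (r : Word), S.input = lift (w.flatMap encodeRat) ++ r →
    S.tags = tagWord V → w.length = (prevs V).length → S.input.length ≤ B →
    Runs O (each .tags fun g => .push .tags' g ;; weightStep g) S.store
      { S with
        input := r
        layer := (lift ((expand (V.map Prod.fst) w).flatMap encodeRat)).reverse ++ S.layer
        tags := []
        tags' := (tagWord V).reverse ++ S.tags' }.store
      (V.length * (2 * B + 3) + 2) := by
  induction V with
  | nil =>
    intro S w r hi ht hw _
    obtain rfl : w = [] := by simpa [prevs] using hw
    refine (Runs.each_nil (by simpa using ht)).congr ?_ (by simp)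
    cases S
    simp_all [expand]
  | cons p V ih =>
    intro S w r hi ht hw hl
    rw [prevs_cons] at hw
    -- The common end of the four cases: `l` is what the first tag contributes to the layer, and
    -- `w'` are the weights left for the others.
    have done : ∀ (w' : List ℚ) (l : Word), w'.length = (prevs V).length →
        (lift (w'.flatMap encodeRat) ++ r).length ≤ B →
        lift ((expand (p.1 :: V.map Prod.fst) w).flatMap encodeRat) =
          l ++ lift ((expand (V.map Prod.fst) w').flatMap encodeRat) →
        Runs O (weightStep (.inr p.1))
          { S with
            tags := tagWord V
            tags' := .inr p.1 :: S.tags' }.store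
          { S with
            input := lift (w'.flatMap encodeRat) ++ r
            layer := l.reverse ++ S.layer
            tags := tagWord V
            tags' := .inr p.1 :: S.tags' }.store (2 * B + 1) →
        Runs O (each .tags fun g => .push .tags' g ;; weightStep g) S.store
          { S with
            input := r
            layer := (lift ((expand ((p :: V).map Prod.fst) w).flatMap encodeRat)).reverse ++
              S.layer
            tags := []
            tags' := (tagWord (p :: V)).reverse ++ S.tags' }.store
          ((p :: V).length * (2 * B + 3) + 2) := by
      intro w' l hw' hl' hexp h
      refine (Runs.each_cons (g := .inr p.1) (w := tagWord V) (by simpa using ht)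
        ((Runs.push _ _).seq (by simpa using h))
        (ih _ w' r rfl rfl hw' hl')).congr ?_ ?_
      · simp [hexp]
      · simp
        nlinarith
    by_cases hp : p.1.isPrev
    · rw [if_pos hp] at hw
      cases w with
      | nil => simp at hw
      | cons c w =>
        have hi' : S.input = ratWord c ++ (lift (w.flatMap encodeRat) ++ r) := by
          simp [hi, ratWord]
        have hlen : (ratWord c).length + (lift (w.flatMap encodeRat) ++ r).length ≤ B := by
          rw [← List.length_append, ← hi']
          exact hl
        by_cases hk : p.1.kept
        · refine done w (ratWord c) (by simpa using hw) (by omega) ?_ ?_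
          · simp [expand, hp, hk, ratWord]
          · simp only [weightStep, hp, hk, if_true]
            exact (Runs.readWord_push (by simp) (isWord_rat c) hi').congr (by simp [ratWord])
              (by simp only [ratWord] at hlen; omega)
        · refine done w [] (by simpa using hw) (by omega) ?_ ?_
          · simp [expand, hp, hk]
          · simp only [weightStep, hp, hk, if_true]
            exact (Runs.readWord_skip (isWord_rat c) hi').congr (by simp)
              (by simp only [ratWord] at hlen; omega)
    · rw [if_neg hp] at hw
      by_cases hk : p.1.kept
      · refine done w (ratWord 0) hw (by rwa [← hi]) ?_ ?_
        · simp [expand, hp, hk, ratWord]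
        · simp only [weightStep, hp, hk, if_true]
          exact (Runs.emit _ _).congr (by simp [hi]) (by omega)
      · refine done w [] hw (by rwa [← hi]) ?_ ?_
        · simp [expand, hp, hk]
        · simp only [weightStep, hp, hk]
          exact Runs.skip.congr (by simp [hi]) (by omega)

end

section

variable {F : Set (ℝ → ℝ)} {O : Set (List Symbol)}

/-! ### Processing a node -/

section

variable (hid : id ∈ F) (name : F ↪ List Bool)

/-- A bound for the lengths of the constants in the programs. -/
def constBound : ℕ :=
  (ratWord 0).length + (ratWord 1).length + (ratWord (-1)).length + (idWord hid name).length + 1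

/-- Push the nodes with the identity as activation and the rows with single entries `cs` as
weights. -/
def emitNodes (a k : Stack) (cs : List ℚ) : Prog :=
  emitSquare a k (ratWord 0) (idWord hid name) [.inl endNeuron] (cs.map ratWord)

/-- Make the layer for the next node from the code of the node. -/
def buildLayer : Prog :=
  emitNodes hid name .units .layer [1] ;; readWord (.push .layer) ;; readWord (.push .layer) ;;
    (each .tags fun g => .push .tags' g ;; weightStep g) ;; pop .input (fun _ => .skip) ;;
    emit .layer [.inl endNeuron, .inl endLayer]

/-- The tag of a new value. -/
def newTag (b : Bool) : Tag := ⟨false, false, .cur, b⟩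

/-- Ask whether the last node of the new layer computes the zero function. Drop the layer if so. -/
def askLayer : Prog :=
  .push .units mark ;; emitNodes hid name .units .out [1] ;;
    emit .out [.inl endLayer, .inl endNetwork] ;; move .out .query ;; copy .layer .temp .query ;;
    copy .pre .out .query ;; move .out .pre ;; .ask ;;
    pop .query (fun o =>
      if o = some (.inl (bit true)) then move .temp .pre ;; .push .tags' (.inr (newTag true))
      else clear .temp ;; pop .units (fun _ => .skip) ;; .push .tags' (.inr (newTag false))) ;;
    move .tags' .tags

end

variable {hid : id ∈ F} {name : F ↪ List Bool} {B : ℕ}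

theorem Runs.emitNodes {a k : Stack} {s : Store} {cs : List ℚ} (hB : constBound hid name ≤ B)
    (hcs : ∀ c ∈ cs, c = 1 ∨ c = -1) (hak : a ≠ k) (ha : a ≠ .temp) (ha' : a ≠ .units')
    (hk : k ≠ .temp) (hk' : k ≠ .units') (ht : s .temp = []) (hu : s .units' = [])
    (hsB : (s a).length ≤ B + 1) :
    Runs O (emitNodes hid name a k cs) s (update s k
      ((lift ((squareLayer hid cs (s a).length).flatMap (encodeNeuron name))).reverse ++ s k))
      ((B + 2) * ((cs.length + 2) * ((B + 4) * (B + 5)))) := by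
  rw [constBound] at hB
  refine (Runs.emitSquare (L := B) (by omega) (by omega) (by simp; omega) ?_ hak ha ha' hk hk' ht
    hu).congr (by rw [lift_squareLayer]) ?_
  · intro w hw
    obtain ⟨c, hc, rfl⟩ := List.mem_map.1 hw
    rcases hcs c hc with rfl | rfl <;> omega
  · rw [List.length_map]
    exact Nat.mul_le_mul (by omega) (Nat.mul_le_mul_left _ (Nat.mul_le_mul (by omega) le_rfl))

/-- The layers that have been built so far, on the stack `pre`. -/
def preWord (name : F ↪ List Bool) (n : ℕ) (Ls : List (Layer F)) : Word :=
  (lift (encodeBits endWord (List.replicate n true) ++ Ls.flatMap (encodeLayer name))).reverse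

/-- The stacks between the nodes: the values `V` have been processed, the layers `Ls` have been
built, and `w` remains to be read. -/
def conf (name : F ↪ List Bool) (n : ℕ) (Ls : List (Layer F)) (V : List Value) (w : Word) :
    Stacks where
  input := w
  pre := preWord name n Ls
  tags := tagWord V
  units := marks (kept V).length

/-- A time bound for `buildLayer`. -/
def buildTime (B : ℕ) : ℕ := (B + 2) * (3 * ((B + 4) * (B + 5))) + B * (2 * B + 3) + 4 * B + 10

theorem runs_buildLayer {n : ℕ} {Ls : List (Layer F)} {V : List Value} {v : Neuron F} {w : Word}
    (hB : constBound hid name ≤ B) (hV : V.length ≤ B)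
    (hw : (lift (encodeNeuron name v) ++ w).length ≤ B)
    (hv : v.weights.length = (prevs V).length) :
    Runs O (buildLayer hid name) (conf name n Ls V (lift (encodeNeuron name v) ++ w)).store
      { conf name n Ls V w with
        tags := []
        tags' := (tagWord V).reverse
        layer := (lift (encodeLayer name
          (nextLayer hid (kept V).length (v.expand (V.map Prod.fst))))).reverse }.store
      (buildTime B) := by
  have hkV := length_kept_le V
  have hB0 : (ratWord 0).length ≤ B := by rw [constBound] at hB; omega
  obtain ⟨e₁, h₁⟩ : ∃ e, e = lift (encodeBits endWord (name v.activation)) := ⟨_, rfl⟩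
  obtain ⟨e₂, h₂⟩ : ∃ e, e = lift (encodeRat v.bias) := ⟨_, rfl⟩
  -- The `endNeuron` left by the weights is popped from the input and written again together with
  -- `endLayer`.
  obtain ⟨r, hr⟩ : ∃ r, r = Sum.inl endNeuron :: w := ⟨_, rfl⟩
  have hin : lift (encodeNeuron name v) ++ w =
      e₁ ++ (e₂ ++ (lift (v.weights.flatMap encodeRat) ++ r)) := by
    simp [encodeNeuron, h₁, h₂, hr]
  rw [hin] at hw ⊢
  simp only [List.length_append] at hw
  obtain ⟨q, hq⟩ : ∃ q, q = lift ((squareLayer hid [1] (kept V).length).flatMap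
    (encodeNeuron name)) := ⟨_, rfl⟩
  have run₁ : Runs O (emitNodes hid name .units .layer [1])
      (conf name n Ls V (e₁ ++ (e₂ ++ (lift (v.weights.flatMap encodeRat) ++ r)))).store
      { conf name n Ls V (e₁ ++ (e₂ ++ (lift (v.weights.flatMap encodeRat) ++ r))) with
        layer := q.reverse }.store _ :=
    (Runs.emitNodes hB (by simp) (by simp) (by simp) (by simp) (by simp) (by simp) rfl rfl
      (by simp [conf]; omega)).congr (by simp [conf, hq]) le_rfl
  have run₂ := Runs.readWord_push (O := O) (k := .layer) (s := Stacks.store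
    { conf name n Ls V (e₁ ++ (e₂ ++ (lift (v.weights.flatMap encodeRat) ++ r))) with
        layer := q.reverse }) (by simp) (h₁ ▸ isWord_bits _) rfl
  have run₃ := Runs.readWord_push (O := O) (k := .layer) (s := Stacks.store
    { conf name n Ls V (e₂ ++ (lift (v.weights.flatMap encodeRat) ++ r)) with
        layer := e₁.reverse ++ q.reverse }) (by simp) (h₂ ▸ isWord_rat _) rfl
  have run₄ := runs_weights (O := O) B hB0 V
    { conf name n Ls V (lift (v.weights.flatMap encodeRat) ++ r) with
        layer := e₂.reverse ++ (e₁.reverse ++ q.reverse) } v.weights r rfl rfl hv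
    (by simp [conf] at hw ⊢; omega)
  refine (run₁.seq (Runs.seq (run₂.congr ?_ le_rfl) (Runs.seq (run₃.congr ?_ le_rfl)
    (run₄.seq ((Runs.pop Runs.skip).seq (Runs.emit _ _)))))).congr ?_ ?_
  · simp [conf]
  · simp [conf]
  · simp [conf, hr, hq, h₁, h₂, nextLayer, encodeLayer, encodeNeuron, Neuron.expand]
  · have : V.length * (2 * B + 3) ≤ B * (2 * B + 3) := Nat.mul_le_mul_right _ hV
    simp [buildTime]
    omega

/-- A time bound for `askLayer`. -/
def askTime (B P : ℕ) : ℕ :=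
  4 * ((B + 2) * (3 * ((B + 4) * (B + 5)))) + 7 * P + 10 * B + 10 * buildTime B + 100

/-- The query is assembled from its end: output layer, new layer, earlier layers. The words on
`layer` and `pre` are stored backwards, so pushing them to `query` symbol by symbol restores the
reading order. Copies in `temp` and `out` allow `pre` to be restored, or extended if the answer is
yes. The mark added to `units` beforehand counts the new node and is removed if that node is
dropped. -/
theorem runs_askLayer {S : Stacks} {l : Word} {ts : Word} {N P : ℕ} {b : Bool}
    (hB : constBound hid name ≤ B) (hN : N ≤ B) (hts : ts.length ≤ B) (hP : S.pre.length ≤ P)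
    (hl : l.length ≤ buildTime B)
    (hS : S = { input := S.input, pre := S.pre, tags' := ts.reverse, units := marks N
                layer := l.reverse })
    (hb : answer O (S.pre.reverse ++ (l ++
      (lift ((squareLayer hid [1] (N + 1)).flatMap (encodeNeuron name)) ++
        [.inl endLayer, .inl endNetwork]))) = .inl (bit b)) :
    Runs O (askLayer hid name) S.store
      { input := S.input
        pre := if b then l.reverse ++ S.pre else S.pre
        tags := ts ++ [.inr (newTag b)]
        units := marks (if b then N + 1 else N) : Stacks }.store
      (askTime B P) := by
  obtain ⟨i, hi⟩ : ∃ i, i = S.input := ⟨_, rfl⟩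
  obtain ⟨p, hp⟩ : ∃ p, p = S.pre := ⟨_, rfl⟩
  rw [← hi, ← hp] at hS
  rw [← hp] at hb hP
  rw [← hi, ← hp, hS]
  obtain ⟨q, hq⟩ : ∃ q, q = lift ((squareLayer hid [1] (N + 1)).flatMap
    (encodeNeuron name)) := ⟨_, rfl⟩
  rw [← hq] at hb
  have run₁ := Runs.emitNodes (O := O) (hid := hid) (name := name) (a := .units) (k := .out)
    (cs := [1]) (s := Stacks.store
      { input := i, pre := p, tags' := ts.reverse, units := marks (N + 1), layer := l.reverse })
    hB (by simp) (by simp) (by simp) (by simp) (by simp) (by simp) rfl rfl (by simp; omega)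
  -- The length of what was written is bounded by the time spent writing it.
  have hql := run₁.length_le .out
  simp [← hq] at run₁ hql
  have last : Runs O (NeuralNet.pop .query (fun o =>
      if o = some (.inl (bit true)) then
        NeuralNet.move .temp .pre ;; Prog.push .tags' (.inr (newTag true))
      else NeuralNet.clear .temp ;; NeuralNet.pop .units (fun _ => .skip) ;;
        Prog.push .tags' (.inr (newTag false))))
      { input := i, pre := p, tags' := ts.reverse, units := marks (N + 1), temp := l
        query := [.inl (bit b)] : Stacks }.store
      { input := i, pre := if b then l.reverse ++ p else p
        tags' := .inr (newTag b) :: ts.reverse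
        units := marks (if b then N + 1 else N) : Stacks }.store
      (2 * buildTime B + 10) := by
    cases b
    · refine (Runs.pop (T := 2 * buildTime B + 9) ?_).mono (by omega)
      simp
      refine ((Runs.clear _).seq ((Runs.pop Runs.skip).seq (Runs.push _ _))).congr ?_ ?_
      · simp [marks_succ]
      · simp
        omega
    · refine (Runs.pop (T := 2 * buildTime B + 9) ?_).mono (by omega)
      simp
      refine ((Runs.move (by simp)).seq (Runs.push _ _)).congr ?_ ?_
      · simp
      · simp
        omega
  refine ((Runs.push _ _).seq (Runs.seq (run₁.conv ?_ rfl le_rfl) ((Runs.emit _ _).seq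
    ((Runs.move (by simp)).seq ((Runs.copy (by simp) (by simp) (by simp)).seq
      ((Runs.copy (by simp) (by simp) (by simp)).seq ((Runs.move (by simp)).seq (Runs.ask.seq
        (Runs.seq (last.conv ?_ rfl le_rfl) (Runs.move (by simp))))))))))).congr ?_ ?_
  · simp [marks_succ]
  · simp [hb]
  · simp
  · simp [askTime]
    omega

/-- Since `Sum.inl` is injective, a query word comes from only one word over the input alphabet.
What the oracle does on words that are not codes is therefore irrelevant. -/
theorem answer_eq {w : List Symbol} {P : Prop} (h : w ∈ O ↔ P) (b : Bool) (hb : P ↔ b = true) :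
    answer O (lift w) = .inl (bit b) := by
  have : (∃ u ∈ O, lift w = u.map Sum.inl) ↔ b = true := by
    rw [← hb, ← h]
    constructor
    · rintro ⟨u, hu, hwu⟩
      rwa [List.map_injective_iff.2 Sum.inl_injective hwu]
    · exact fun hw => ⟨w, hw, rfl⟩
  rw [answer]
  cases b <;> simp_all

/-- Read a node and decide whether it computes the zero function. -/
def readNode (hid : id ∈ F) (name : F ↪ List Bool) : Prog :=
  buildLayer hid name ;; askLayer hid name

/-- One round of the algorithm, with exactly one query. The word `pre` grows by at most one layer,
whose length is bounded by the time taken to build it. -/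
theorem runs_readNode {n : ℕ} {Ls : List (Layer F)} {V : List Value} {v : Neuron F} {w : Word}
    {P : ℕ} (hO : ∀ N : Network F, encodeNetwork name N ∈ O ↔ N.AllNecessary)
    (hB : constBound hid name ≤ B) (hV : V.length ≤ B)
    (hw : (lift (encodeNeuron name v) ++ w).length ≤ B) (hP : (preWord name n Ls).length ≤ P)
    (h : Valid hid n Ls V) (hv : v.weights.length = (prevs V).length) :
    ∃ Ls', Valid hid n Ls' (V ++ [nodeValue n V v]) ∧
      (preWord name n Ls').length ≤ (preWord name n Ls).length + buildTime B ∧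
      Runs O (readNode hid name) (conf name n Ls V (lift (encodeNeuron name v) ++ w)).store
        (conf name n Ls' (V ++ [nodeValue n V v]) w).store (buildTime B + askTime B P) := by
  have run₁ := runs_buildLayer (O := O) (Ls := Ls) (n := n) hB hV hw hv
  have hl := run₁.length_le .layer
  simp [conf] at hl
  have run₂ := runs_askLayer (O := O) (B := B) (P := P) (ts := tagWord V)
    (b := (nodeValue n V v).1.kept) (hid := hid) (name := name)
    (S := { conf name n Ls V w with
        tags := []
        tags' := (tagWord V).reverse
        layer := (lift (encodeLayer name
          (nextLayer hid (kept V).length (v.expand (V.map Prod.fst))))).reverse })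
    hB ((length_kept_le V).trans hV) (by simpa using hV) hP (by simpa using hl) rfl (by
      rw [← answer_eq (hO (h.network v)) _ (h.allNecessary_network hv)]
      congr 1
      simp [encodeNetwork, Valid.network, Computes.network, Network.layers, conf, preWord,
        encodeLayer])
  refine ⟨_, h.next hv, ?_, (run₁.seq run₂).congr ?_ le_rfl⟩
  · split_ifs
    · simp only [preWord, List.length_reverse, length_lift, List.length_append,
        List.flatMap_append, List.flatMap_cons, List.flatMap_nil, List.length_nil]
      omega
    · exact Nat.le_add_right _ _
  · congr 1
    by_cases hk : (nodeValue n V v).1.kept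
    · simp [conf, hk, preWord, kept]
      simp [newTag, nodeValue] at hk ⊢
      exact hk
    · simp [conf, hk, kept]
      simp [newTag, nodeValue] at hk ⊢
      exact hk

end

section

variable {F : Set (ℝ → ℝ)} {O : Set (List Symbol)}

/-! ### Processing layers -/

/-- The functions with tags that satisfy `p`. -/
def select (p : Tag → Bool) (V : List Value) : List (List ℝ → ℝ) :=
  (V.filter fun q => p q.1).map Prod.snd

/-- Change the tags. -/
def retag (f : Tag → Tag) (V : List Value) : List Value := V.map fun q => (f q.1, q.2)

theorem select_append (p : Tag → Bool) (V W : List Value) :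
    select p (V ++ W) = select p V ++ select p W := by simp [select]

theorem select_retag (p : Tag → Bool) (f : Tag → Tag) (V : List Value) :
    select p (retag f V) = select (fun t => p (f t)) V := by
  simp [select, retag, List.filter_map, Function.comp_def]

theorem select_congr {p q : Tag → Bool} {V : List Value} (h : ∀ v ∈ V, p v.1 = q v.1) :
    select p V = select q V := by
  rw [select, List.filter_congr h, select]

theorem select_eq_nil {p : Tag → Bool} {V : List Value} (h : ∀ v ∈ V, p v.1 = false) :
    select p V = [] := by
  simpa [select] using h

theorem select_eq_all {p : Tag → Bool} {V : List Value} (h : ∀ v ∈ V, p v.1 = true) :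
    select p V = V.map Prod.snd := by
  rw [select, List.filter_eq_self.2 h]

theorem length_filter_tags (p : Tag → Bool) (V : List Value) :
    ((V.map Prod.fst).filter p).length = (select p V).length := by
  simp [select, List.filter_map, Function.comp_def]

@[simp] theorem retag_append (f : Tag → Tag) (V W : List Value) :
    retag f (V ++ W) = retag f V ++ retag f W := List.map_append

@[simp] theorem length_retag (f : Tag → Tag) (V : List Value) : (retag f V).length = V.length :=
  List.length_map _

theorem retag_retag (f g : Tag → Tag) (V : List Value) :
    retag f (retag g V) = retag (fun t => f (g t)) V := by simp [retag]

theorem kept_retag {f : Tag → Tag} (hf : ∀ t, (f t).kept = t.kept) (V : List Value) :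
    kept (retag f V) = kept V :=
  (select_retag Tag.kept f V).trans (select_congr fun v _ => hf v.1)

theorem tagWord_retag (f : Tag → Tag) (V : List Value) :
    tagWord (retag f V) = ((V.map Prod.fst).map f).map .inr := by
  simp [tagWord, retag]

theorem Valid.retag {hid : id ∈ F} {n : ℕ} {Ls : List (Layer F)} {V : List Value}
    (h : Valid hid n Ls V) {f : Tag → Tag} (hf : ∀ t, (f t).kept = t.kept) :
    Valid hid n Ls (retag f V) := by
  refine ⟨by rw [kept_retag hf]; exact h.computes, fun p hp hk => ?_⟩
  obtain ⟨q, hq, rfl⟩ := List.mem_map.1 hp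
  exact h.dropped q hq (by rwa [hf] at hk)

/-- The status at the end of a layer. -/
def Status.next : Status → Status
  | .cur => .prev
  | _ => .old

/-- The tag at the end of a layer. -/
def Tag.next (t : Tag) : Tag := { t with status := t.status.next }

/-- No value belongs to the current layer. -/
def Between (V : List Value) : Prop := ∀ p ∈ V, p.1.status ≠ .cur

/-- The values after reading the layer `L`. -/
noncomputable def readLayer (n : ℕ) (V : List Value) (L : Layer F) : List Value :=
  retag Tag.next (V ++ L.map (nodeValue n V))

/-- The values after reading the layers `Ls`. -/
noncomputable def readValues (n : ℕ) : List Value → List (Layer F) → List Value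
  | V, [] => V
  | V, L :: Ls => readValues n (readLayer n V L) Ls

theorem between_retag {f : Tag → Tag} (hf : ∀ t, (f t).status ≠ .cur) (V : List Value) :
    Between (retag f V) := by
  intro p hp
  obtain ⟨q, _, rfl⟩ := List.mem_map.1 hp
  exact hf q.1

theorem Tag.status_next_ne (t : Tag) : t.next.status ≠ .cur := by
  rcases t with ⟨_, _, _ | _ | _, _⟩ <;> simp [Tag.next, Status.next]

theorem between_readLayer (n : ℕ) (V : List Value) (L : Layer F) : Between (readLayer n V L) :=
  between_retag Tag.status_next_ne _

/-- Status moves from `cur` to `prev` to `old`; if nothing is current, nothing becomes previous. -/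
theorem prevs_retag_next {V : List Value} (hV : Between V) : prevs (retag Tag.next V) = [] := by
  refine select_eq_nil (p := Tag.isPrev) fun p hp => ?_
  obtain ⟨q, hq, rfl⟩ := List.mem_map.1 hp
  have := hV q hq
  cases h : q.1.status <;> simp_all [Tag.isPrev, Tag.next, Status.next]

theorem prevs_readLayer (n : ℕ) {V : List Value} (hV : Between V) (L : Layer F) :
    prevs (readLayer n V L) = L.map (nodeFun V) := by
  rw [readLayer, retag_append, prevs_append, prevs_retag_next hV, List.nil_append]
  refine (select_eq_all (p := Tag.isPrev) ?_).trans ?_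
  · intro p hp
    obtain ⟨q, hq, rfl⟩ := List.mem_map.1 hp
    obtain ⟨v, _, rfl⟩ := List.mem_map.1 hq
    simp [Tag.isPrev, Tag.next, Status.next, nodeValue]
  · simp [retag, nodeValue]

theorem length_readLayer (n : ℕ) (V : List Value) (L : Layer F) :
    (readLayer n V L).length = V.length + L.length := by
  simp [readLayer]

/-- After reading at least one layer, the old values are no longer used, and the values of the last
layer are the output. -/
theorem readValues_spec (n : ℕ) (L : Layer F) (Ls : List (Layer F)) {V : List Value}
    (hV : Between V) : ∃ W, readValues n V (L :: Ls) = retag Tag.next V ++ W ∧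
      (∀ p ∈ W, p.1.isInput = false ∧ p.1.isOutput = false) ∧ Between (readValues n V (L :: Ls)) ∧
      ∀ x, (prevs (readValues n V (L :: Ls))).map (fun f => f x) =
        evalLayers (L :: Ls) ((prevs V).map fun f => f x) := by
  induction Ls generalizing V L with
  | nil =>
    refine ⟨retag Tag.next (L.map (nodeValue n V)), retag_append _ _ _, ?_,
      between_readLayer n V L, fun x => ?_⟩
    · intro p hp
      obtain ⟨q, hq, rfl⟩ := List.mem_map.1 hp
      obtain ⟨v, _, rfl⟩ := List.mem_map.1 hq
      exact ⟨rfl, rfl⟩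
    · change (prevs (readLayer n V L)).map _ = _
      rw [prevs_readLayer n hV, List.map_map]
      rfl
  | cons L' Ls ih =>
    obtain ⟨W, h₁, h₂, h₃, h₄⟩ := ih L' (between_readLayer n V L)
    refine ⟨retag Tag.next (retag Tag.next (L.map (nodeValue n V))) ++ W, ?_, ?_, h₃, fun x => ?_⟩
    · rw [readValues, h₁, readLayer, retag_append, retag_append, List.append_assoc]
      congr 1
      -- Without current values a single shift already makes every status `old`, so the second shift
      -- does nothing.
      rw [retag_retag, retag, retag]
      refine List.map_congr_left fun p hp => ?_
      have := hV p hp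
      cases h : p.1.status <;> simp_all [Tag.next, Status.next]
    · intro p hp
      rcases List.mem_append.1 hp with hp | hp
      · rw [retag_retag] at hp
        obtain ⟨q, hq, rfl⟩ := List.mem_map.1 hp
        obtain ⟨v, _, rfl⟩ := List.mem_map.1 hq
        exact ⟨rfl, rfl⟩
      · exact h₂ p hp
    · rw [readValues, h₄ x, prevs_readLayer n hV, List.map_map]
      rfl

/-- Read layers until the end of the network. -/
def readLayers (hid : id ∈ F) (name : F ↪ List Bool) : Prog :=
  .loop .input (fun o => o.elim .skip fun g =>
    if g = .inl endNetwork then .skip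
    else if g = .inl endLayer then relabel Tag.next
    else .push .input g ;; readNode hid name)
    fun o => o.isSome && !decide (o = some (.inl endNetwork))

variable {hid : id ∈ F} {name : F ↪ List Bool} {B : ℕ}

/-- A time bound for reading a node. -/
def nodeTime (B : ℕ) : ℕ := 2 + buildTime B + askTime B ((B + 1) * buildTime B)

theorem one_le_length_encodeNeuron (v : Neuron F) : 1 ≤ (encodeNeuron name v).length := by
  simp [encodeNeuron]
  omega

theorem head_encodeNeuron (v : Neuron F) : ∃ g r, lift (encodeNeuron name v) = g :: r ∧
    g ≠ .inl endNetwork ∧ g ≠ .inl endLayer := by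
  rcases h : name v.activation with _ | ⟨c, w⟩ <;>
    exact ⟨_, _, by simp only [encodeNeuron, encodeBits, h, List.map_nil, List.map_cons,
      List.nil_append, List.cons_append, lift_cons]; rfl, by simp⟩

/-- Nodes of the layer being read have status `cur`, so adding them does not change `prevs`; by this
lemma every node of a layer is evaluated against the same values. -/
theorem nodeValue_congr (n : ℕ) {V W : List Value} (h : prevs W = prevs V) :
    nodeValue (F := F) n W = nodeValue n V := by
  have : nodeFun (F := F) W = nodeFun V := by
    funext v x
    rw [nodeFun, nodeFun, h]
  funext v
  rw [nodeValue, nodeValue, this]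

/-- Nodes and layer ends are handled by one and the same loop, so the statement prepends the reading
of nodes to an arbitrary later run of that loop. Remaining input plus number of values stays below
`B`, because each node occupies at least one symbol; `pre` grows by at most `buildTime B` per value.
-/
theorem runs_nodes {n : ℕ} (hO : ∀ N : Network F, encodeNetwork name N ∈ O ↔ N.AllNecessary)
    (hB : constBound hid name ≤ B) (w : Word) (L : Layer F) :
    ∀ (V : List Value) (Ls : List (Layer F)), Valid hid n Ls V →
    (∀ v ∈ L, v.weights.length = (prevs V).length) →
    (lift (L.flatMap (encodeNeuron name)) ++ w).length + V.length ≤ B →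
    (preWord name n Ls).length ≤ (V.length + 1) * buildTime B →
    ∃ Ls', Valid hid n Ls' (V ++ L.map (nodeValue n V)) ∧
      (preWord name n Ls').length ≤ (V.length + L.length + 1) * buildTime B ∧
      ∀ s T, Runs O (readLayers hid name)
          (conf name n Ls' (V ++ L.map (nodeValue n V)) w).store s T →
        Runs O (readLayers hid name)
          (conf name n Ls V (lift (L.flatMap (encodeNeuron name)) ++ w)).store s
          (L.length * nodeTime B + T) := by
  induction L with
  | nil =>
    intro V Ls hV _ _ hP
    exact ⟨Ls, by simpa using hV, hP, fun s T h => by simpa using h⟩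
  | cons v L ih =>
    intro V Ls hV hw hl hP
    have hp : prevs (V ++ [nodeValue n V v]) = prevs V := by
      simp [prevs, nodeValue, Tag.isPrev]
    have hnv := nodeValue_congr (F := F) n hp
    have hlen : (V ++ [nodeValue n V v]).length = V.length + 1 := by simp
    have h1 := one_le_length_encodeNeuron (name := name) v
    have hsplit : lift ((v :: L).flatMap (encodeNeuron name)) ++ w =
        lift (encodeNeuron name v) ++ (lift (L.flatMap (encodeNeuron name)) ++ w) := by simp
    rw [hsplit] at hl ⊢
    have hl' : (lift (encodeNeuron name v)).length +
        (lift (L.flatMap (encodeNeuron name)) ++ w).length + V.length ≤ B := by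
      rwa [List.length_append] at hl
    rw [length_lift] at hl'
    obtain ⟨Ls₁, hV₁, hP₁, run₁⟩ := runs_readNode (P := (B + 1) * buildTime B)
      (w := lift (L.flatMap (encodeNeuron name)) ++ w) hO hB (by omega : V.length ≤ B) (by omega)
      (hP.trans (Nat.mul_le_mul_right _ (by omega))) hV
      (hw v (by simp))
    obtain ⟨Ls₂, hV₂, hP₂, run₂⟩ := ih (V ++ [nodeValue n V v]) Ls₁ hV₁
      (fun u hu => by rw [hp]; exact hw u (by simp [hu]))
      (by omega)
      (by
        rw [hlen, Nat.add_mul (V.length + 1), one_mul]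
        omega)
    rw [hnv, List.append_assoc] at hV₂ run₂
    refine ⟨Ls₂, by simpa using hV₂, ?_, fun s T h => ?_⟩
    · refine hP₂.trans (le_of_eq ?_)
      rw [hlen, List.length_cons]
      ring
    · obtain ⟨g, r, hg, hg₁, hg₂⟩ := head_encodeNeuron (name := name) v
      -- The additional step puts back the symbol that the loop popped to see that a node follows.
      refine (Runs.next (T₁ := 1 + (buildTime B + askTime B ((B + 1) * buildTime B)))
        (by simp [conf, hg, hg₁]) ?_ (run₂ s T (by simpa using h))).mono ?_
      · have : (((conf name n Ls V (lift (encodeNeuron name v) ++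
            (lift (L.flatMap (encodeNeuron name)) ++ w))).store .input).head?) = some g := by
          simp [conf, hg]
        rw [this]
        simp only [Option.elim_some, if_neg hg₁, if_neg hg₂]
        refine (Runs.push _ _).seq (run₁.conv ?_ rfl le_rfl)
        simp [conf, hg]
      · simp [nodeTime]
        nlinarith

/-- A time bound per symbol for reading layers. -/
def symbolTime (B : ℕ) : ℕ := nodeTime B + 5 * B + 10

theorem length_le_encodeLayer (L : Layer F) : L.length + 1 ≤ (encodeLayer name L).length := by
  simp only [encodeLayer, List.length_append, List.length_singleton, Nat.add_le_add_iff_right]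
  induction L with
  | nil => simp
  | cons v L ih =>
    have := one_le_length_encodeNeuron (name := name) v
    simp only [List.flatMap_cons, List.length_append, List.length_cons]
    omega

theorem runs_relabel {n : ℕ} {f : Tag → Tag} (hf : ∀ t, (f t).kept = t.kept)
    (Ls : List (Layer F)) (V : List Value) (w : Word) :
    Runs O (relabel f) (conf name n Ls V w).store (conf name n Ls (retag f V) w).store
      (5 * V.length + 4) :=
  (Runs.relabel f (conf name n Ls V w) (V.map Prod.fst) rfl rfl).congr
    (by rw [conf, conf, tagWord_retag, kept_retag hf]) (by rw [List.length_map])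

/-- The cost is charged to the symbols read: the code of a layer has at least one symbol per node
and one more, which pays for the change of status at its end. The bound on remaining input plus
values is passed on to the next stage. -/
theorem runs_readLayers {n : ℕ}
    (hO : ∀ N : Network F, encodeNetwork name N ∈ O ↔ N.AllNecessary)
    (hB : constBound hid name ≤ B) (w : Word) (Ks : List (Layer F)) :
    ∀ (V : List Value) (Ls : List (Layer F)), Valid hid n Ls V → Between V →
    WellFormed (prevs V).length Ks →
    (lift (Ks.flatMap (encodeLayer name) ++ [endNetwork]) ++ w).length + V.length ≤ B →
    (preWord name n Ls).length ≤ (V.length + 1) * buildTime B →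
    ∃ Ls', Valid hid n Ls' (readValues n V Ks) ∧
      (preWord name n Ls').length ≤ ((readValues n V Ks).length + 1) * buildTime B ∧
      w.length + (readValues n V Ks).length ≤
        (lift (Ks.flatMap (encodeLayer name) ++ [endNetwork]) ++ w).length + V.length ∧
      Runs O (readLayers hid name)
        (conf name n Ls V (lift (Ks.flatMap (encodeLayer name) ++ [endNetwork]) ++ w)).store
        (conf name n Ls' (readValues n V Ks) w).store
        ((lift (Ks.flatMap (encodeLayer name) ++ [endNetwork])).length * symbolTime B) := by
  induction Ks with
  | nil =>
    intro V Ls hV _ _ _ hP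
    refine ⟨Ls, hV, hP, by simp [readValues], ?_⟩
    refine (Runs.leave (by simp [conf]) (by simpa [conf] using Runs.skip)).congr ?_ ?_
    · simp [readValues, conf]
    · simp [symbolTime]
  | cons L Ks ih =>
    intro V Ls hV hVb hwf hl hP
    have hsplit : lift ((L :: Ks).flatMap (encodeLayer name) ++ [endNetwork]) ++ w =
        lift (L.flatMap (encodeNeuron name)) ++
          (.inl endLayer :: (lift (Ks.flatMap (encodeLayer name) ++ [endNetwork]) ++ w)) := by
      simp [encodeLayer]
    have hL := length_le_encodeLayer (name := name) L
    have hlen : (lift ((L :: Ks).flatMap (encodeLayer name) ++ [endNetwork]) ++ w).length =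
        (encodeLayer name L).length +
          (lift (Ks.flatMap (encodeLayer name) ++ [endNetwork]) ++ w).length := by
      simp
    obtain ⟨Ls₁, hV₁, hP₁, run₁⟩ := runs_nodes hO hB
      (.inl endLayer :: (lift (Ks.flatMap (encodeLayer name) ++ [endNetwork]) ++ w)) L V Ls hV
      hwf.1 (by rwa [← hsplit]) hP
    have hlV := length_readLayer n V L
    obtain ⟨Ls₂, hV₂, hP₂, hl₂, run₂⟩ := ih (readLayer n V L) Ls₁
      (hV₁.retag fun _ => rfl) (between_readLayer n V L)
      (by rw [prevs_readLayer n hVb, List.length_map]; exact hwf.2)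
      (by omega) (by rwa [hlV])
    refine ⟨Ls₂, hV₂, hP₂, ?_, ?_⟩
    · rw [readValues]
      omega
    · rw [hsplit]
      refine (run₁ _ _ (Runs.next (T₁ := 5 * B + 4) (by simp [conf]) ?_ run₂)).mono ?_
      · have : (V ++ L.map (nodeValue n V)).length ≤ B := by
          simp
          omega
        refine (runs_relabel (f := Tag.next) (fun _ => rfl) Ls₁ (V ++ L.map (nodeValue n V))
          (lift (Ks.flatMap (encodeLayer name) ++ [endNetwork]) ++ w)).conv ?_ rfl (by omega)
        simp [conf]
      · have hlen' : (lift ((L :: Ks).flatMap (encodeLayer name) ++ [endNetwork])).length =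
            (encodeLayer name L).length +
              (lift (Ks.flatMap (encodeLayer name) ++ [endNetwork])).length := by
          simp
        rw [hlen', Nat.add_mul]
        have h₁ : (L.length + 1) * symbolTime B ≤ (encodeLayer name L).length * symbolTime B :=
          Nat.mul_le_mul_right _ hL
        have h₂ : L.length * nodeTime B ≤ L.length * symbolTime B :=
          Nat.mul_le_mul_left _ (by rw [symbolTime]; omega)
        rw [Nat.add_mul, one_mul] at h₁
        have h₃ : 5 * B + 10 ≤ symbolTime B := by rw [symbolTime]; omega
        omega

end

section

variable {F : Set (ℝ → ℝ)} {O : Set (List Symbol)}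

/-! ### The reduction -/

/-- The tag when the differences of the outputs are computed: they depend on the outputs of the
first network and on those of the second one. -/
def Tag.startDifference (t : Tag) : Tag :=
  { t with status := if t.isOutput || t.isPrev then .prev else .old }

/-- The tag at the beginning of the second network. -/
def Tag.startSecond (t : Tag) : Tag :=
  { t with isOutput := t.isPrev, status := if t.isInput then .prev else .old }

/-- The tag of an input. -/
def inputTag : Tag := ⟨true, false, .prev, true⟩

/-- The symbols of a word before `endWord` are counted. -/
def countStep (p : Prog) (g : Cell) : Prog := if g = .inl endWord then .skip else p

section

variable (hid : id ∈ F) (name : F ↪ List Bool)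

/-- Push marks to `fail` unless the outputs of both networks agree. -/
def differenceProg : Prog :=
  relabel Tag.startDifference ;; emitNodes hid name .count₃ .layer [1, -1] ;; clear .count₃ ;;
    emit .layer [.inl endLayer, .inl endNetwork] ;; move .layer .input ;; readLayers hid name ;;
    countTags (fun t => t.isPrev && t.kept) .fail

/-- Read the layers of the second network and compare it with the first one. -/
def secondProg : Prog :=
  readLayers hid name ;; countTags Tag.isOutput .count₁ ;; countTags Tag.isPrev .count₂ ;;
    countTags Tag.isOutput .count₃ ;; compareCounts ;;
    pop .fail fun o => o.elim (differenceProg hid name) (.push .fail)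

/-- Decide whether two networks are equivalent. -/
def equivalenceProg : Prog :=
  readWord (fun g => .push .pre g ;;
      countStep (.push .units mark ;; .push .tags (.inr inputTag)) g) ;;
    readLayers hid name ;; relabel Tag.startSecond ;;
    readWord (countStep (.push .count₁ mark)) ;; countTags Tag.isInput .count₂ ;;
    compareCounts ;; pop .fail fun o => o.elim (secondProg hid name) (.push .fail)

end

variable {hid : id ∈ F} {name : F ↪ List Bool}

/-- A bound for the heights of the stacks `input` and `tags`. -/
def sizeBound (b : ℕ) : ℕ := (b + 2) * (4 * ((b + 4) * (b + 5))) + b + 2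

theorem le_sizeBound (b : ℕ) : b ≤ sizeBound b := by
  rw [sizeBound]
  omega

/-- A time bound for `differenceProg`. -/
def differenceTime (b : ℕ) : ℕ :=
  sizeBound b * symbolTime (sizeBound b) + 20 * sizeBound b + 50

/-- After a layer has been read, only its own nodes have status `prev`, and their `kept` bits say
whether they are nonzero on inputs of length `n`. -/
theorem length_filter_eq_zero_iff {n : ℕ} {V : List Value} (hV : Between V) (L : Layer F) :
    (((readLayer n V L).map Prod.fst).filter fun t => t.isPrev && t.kept).length = 0 ↔
      ∀ x : List ℝ, x.length = n → ∀ t ∈ L.eval ((prevs V).map fun f => f x), t = 0 := by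
  have h₁ : ∀ p ∈ retag Tag.next V, (p.1.isPrev && p.1.kept) = false := by
    intro p hp
    have : prevs (retag Tag.next V) = [] := prevs_retag_next hV
    simp only [prevs, List.map_eq_nil_iff, List.filter_eq_nil_iff] at this
    simp [this p hp]
  rw [length_filter_tags (fun t => t.isPrev && t.kept), readLayer, retag_append, select_append,
    select_eq_nil h₁, List.nil_append, List.length_eq_zero_iff, select, List.map_eq_nil_iff,
    List.filter_eq_nil_iff]
  constructor
  · intro h x hx t ht
    obtain ⟨v, hv, rfl⟩ := List.mem_map.1 ht
    have := h (Tag.next (nodeValue n V v).1, (nodeValue n V v).2)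
      (List.mem_map_of_mem (List.mem_map_of_mem hv))
    simp [Tag.next, Status.next, nodeValue, Tag.isPrev] at this
    exact this x hx
  · intro h p hp
    obtain ⟨q, hq, rfl⟩ := List.mem_map.1 hp
    obtain ⟨v, hv, rfl⟩ := List.mem_map.1 hq
    simp [Tag.next, Status.next, nodeValue, Tag.isPrev]
    exact fun x hx => h x hx _ (List.mem_map_of_mem hv)

/-- The differences are treated as one further layer, whose code is placed on the empty input stack
and read like any other. Values stay in order of creation, so the outputs of the first network
precede those of the second, and the rows with `1` and `-1` subtract them. The marks on `fail` count
the nonzero differences. -/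
theorem runs_difference {n m b : ℕ} {Ls : List (Layer F)} {V : List Value}
    {fs gs : List (List ℝ → ℝ)}
    (hO : ∀ N : Network F, encodeNetwork name N ∈ O ↔ N.AllNecessary)
    (hb : constBound hid name ≤ b) (hV : Valid hid n Ls V) (hlen : V.length ≤ b) (hm : m ≤ b)
    (hP : (preWord name n Ls).length ≤ (V.length + 1) * buildTime (sizeBound b))
    (hsel : select (fun t => t.isOutput || t.isPrev) V = fs ++ gs) (hfs : fs.length = m)
    (hgs : gs.length = m) :
    ∃ s, Runs O (differenceProg hid name)
        { conf name n Ls V [] with count₃ := marks m }.store s (differenceTime b) ∧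
      (s .fail = [] ↔
        ∀ x : List ℝ, x.length = n → (fs.map fun f => f x) = gs.map fun f => f x) := by
  obtain ⟨B, hB⟩ : ∃ B, B = sizeBound b := ⟨_, rfl⟩
  have hbB := le_sizeBound b
  obtain ⟨U, hU⟩ : ∃ U, U = retag Tag.startDifference V := ⟨_, rfl⟩
  obtain ⟨D, hD⟩ : ∃ D, D = squareLayer hid [1, -1] m := ⟨_, rfl⟩
  have hUV : Valid hid n Ls U := hU ▸ hV.retag fun _ => rfl
  have hUb : Between U := hU ▸ between_retag
    (fun t => by unfold Tag.startDifference; split_ifs <;> simp) V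
  have hUl : U.length = V.length := by rw [hU, length_retag]
  have hUp : prevs U = fs ++ gs := by
    rw [hU, ← hsel]
    refine (select_retag Tag.isPrev _ V).trans (select_congr fun v _ => ?_)
    simp only [Tag.isPrev, Tag.startDifference]
    split_ifs with h <;> simp_all
  have run₁ := Runs.relabel (O := O) Tag.startDifference
    { conf name n Ls V [] with count₃ := marks m } (V.map Prod.fst) rfl rfl
  have run₂ := Runs.emitNodes (O := O) (hid := hid) (name := name) (a := .count₃) (k := .layer)
    (cs := [1, -1]) (s := Stacks.store { conf name n Ls U [] with count₃ := marks m }) hb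
    (by simp) (by simp) (by simp) (by simp) (by simp) (by simp) rfl rfl (by simp; omega)
  have hDl := run₂.length_le .layer
  have hw : lift ([D].flatMap (encodeLayer name) ++ [endNetwork]) ++ [] =
      lift (D.flatMap (encodeNeuron name)) ++ [.inl endLayer, .inl endNetwork] := by
    simp [encodeLayer]
  simp [conf, ← hD] at hDl
  have hlw : (lift ([D].flatMap (encodeLayer name) ++ [endNetwork]) ++ []).length =
      (D.flatMap (encodeNeuron name)).length + 2 := by
    rw [hw]
    simp
  obtain ⟨Ls', -, -, hl, run₃⟩ := runs_readLayers hO (hb.trans hbB) [] [D] U Ls hUV hUb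
    ⟨fun v hv => by
      rw [hUp, hD] at *
      rw [length_weights_squareLayer hv]
      simp [hfs, hgs]
      omega, trivial⟩
    (by
      -- The bound `sizeBound b` consists of the writing time for two rows per node, at most `b`
      -- values, and the two end symbols.
      rw [hlw, hUl, sizeBound]
      simp only [List.length_flatMap]
      omega) (by rwa [hUl])
  have run₄ := Runs.countTags (O := O) (fun t => t.isPrev && t.kept) (k := .fail) (by simp)
    (by simp) (conf name n Ls' (readValues n U [D]) []) _ rfl rfl
  refine ⟨_, ((run₁.conv rfl ?_ le_rfl).seq (run₂.seq ((Runs.clear _).seq ((Runs.emit _ _).seq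
    ((Runs.move (by simp)).seq (Runs.seq (run₃.conv ?_ rfl le_rfl) run₄)))))).mono ?_, ?_⟩
  · rw [conf, conf, hU, tagWord_retag, kept_retag (f := Tag.startDifference) (fun _ => rfl)]
  · simp [conf, ← hD]
    simp [encodeLayer]
  · simp [conf, ← hD]
    simp only [List.length_flatMap] at hlw
    have h₁ : (encodeLayer name D).length =
        (D.map fun a => (encodeNeuron name a).length).sum + 1 := by
      simp [encodeLayer]
    rw [hlw, hUl, List.length_nil] at hl
    have h₂ : (encodeLayer name D).length + 1 ≤ sizeBound b := by
      rw [h₁, sizeBound]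
      omega
    have h₃ := Nat.mul_le_mul_right (symbolTime (sizeBound b)) h₂
    rw [differenceTime]
    have h₄ : (b + 2) * (4 * ((b + 4) * (b + 5))) + b + 2 = sizeBound b := rfl
    omega
  · simp only [Stacks.update_fail, Stacks.store_fail]
    have := length_filter_eq_zero_iff (n := n) hUb D
    have h0 : ∀ k, marks k ++ (conf name n Ls' (readValues n U [D]) []).fail = [] ↔ k = 0 := by
      intro k
      cases k <;> simp [conf, marks]
    rw [h0]
    refine this.trans (forall_congr' fun x => imp_congr_right fun hx => ?_)
    rw [hUp, hD, List.map_append, eval_difference hid (by simpa using hfs) (by simpa using hgs),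
      zipWith_sub_eq_zero (by simp [hfs, hgs])]

/-- A mark on `fail` records that the sizes differ and the answer is no; it is put back and the rest
of the computation is skipped. -/
theorem Runs.ifEmpty {p : Prog} {S : Stacks} {k T : ℕ} {P : Prop} (hf : S.fail = marks k)
    (h₀ : k = 0 → ∃ s, Runs O p S.store s T ∧ (s .fail = [] ↔ P)) (h₁ : k ≠ 0 → ¬ P) :
    ∃ s, Runs O (NeuralNet.pop .fail fun o => o.elim p (.push .fail)) S.store s (T + 2) ∧
      (s .fail = [] ↔ P) := by
  rcases k with _ | k
  · obtain ⟨s, h, hs⟩ := h₀ rfl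
    refine ⟨s, (Runs.pop (T := T) ?_).mono (by omega), hs⟩
    have : S.store .fail = [] := hf
    rw [this]
    refine h.conv ?_ rfl le_rfl
    rw [List.tail_nil, ← this, Function.update_eq_self]
  · refine ⟨S.store, (Runs.pop (T := 1) ?_).mono (by omega), iff_of_false ?_ (h₁ (by omega))⟩
    · have : S.store .fail = mark :: marks k := hf
      rw [this]
      refine (Runs.push _ _).congr ?_ le_rfl
      cases S
      simp_all
    · rw [Stacks.store_fail, hf]
      simp [marks]

theorem length_evalLayers_append (Ls : List (Layer F)) (L : Layer F) (y : List ℝ) :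
    (evalLayers (Ls ++ [L]) y).length = L.length := by
  simp [evalLayers_append, evalLayers]

/-- The outputs of the first network are still there after reading the second one. -/
theorem select_readValues (n : ℕ) {V : List Value} (hV : Between V) (N : Network F) :
    select Tag.isInput (readValues n V N.layers) = select Tag.isInput V ∧
      select Tag.isOutput (readValues n V N.layers) = select Tag.isOutput V ∧
      select (fun t => t.isOutput || t.isPrev) (readValues n V N.layers) =
        select Tag.isOutput V ++ prevs (readValues n V N.layers) ∧
      Between (readValues n V N.layers) ∧
      (prevs (readValues n V N.layers)).length = N.output.length ∧
      ∀ x, (prevs (readValues n V N.layers)).map (fun f => f x) =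
        N.eval ((prevs V).map fun f => f x) := by
  obtain ⟨L, Ks, hL⟩ : ∃ L Ks, N.layers = L :: Ks := by
    rw [← List.ne_nil_iff_exists_cons]
    simp [Network.layers]
  obtain ⟨W, h₁, h₂, h₃, h₄⟩ := readValues_spec n L Ks hV
  rw [← hL] at h₁ h₃ h₄
  have h₅ := prevs_retag_next hV
  refine ⟨?_, ?_, ?_, h₃, ?_, h₄⟩
  · rw [h₁, select_append, select_retag, select_eq_nil fun p hp => (h₂ p hp).1, List.append_nil]
    rfl
  · rw [h₁, select_append, select_retag, select_eq_nil fun p hp => (h₂ p hp).2, List.append_nil]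
    rfl
  · have h₆ : prevs (readValues n V N.layers) = select Tag.isPrev W := by
      rw [h₁, prevs_append, h₅, List.nil_append]
      rfl
    rw [h₆, h₁, select_append]
    congr 1
    · refine (select_congr fun v hv => ?_).trans (select_retag Tag.isOutput Tag.next V)
      -- An older value is no longer `prev`, so selecting by either property finds only the stored
      -- outputs among the older values and only the new outputs in `W`.
      have : v.1.isPrev = false := by
        simp only [prevs, List.map_eq_nil_iff, List.filter_eq_nil_iff] at h₅
        simpa using h₅ v hv
      rw [this, Bool.or_false]
    · exact select_congr fun v hv => by rw [(h₂ v hv).2, Bool.false_or]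
  · have := congrArg List.length (h₄ [])
    rwa [List.length_map, Network.layers, length_evalLayers_append] at this

/-- A time bound for `secondProg`. -/
def secondTime (b : ℕ) : ℕ :=
  sizeBound b * symbolTime (sizeBound b) + 20 * b + 30 + differenceTime b

/-- The numbers of outputs are compared first, since the difference layer makes sense only if they
agree. Their comparison empties its counters, so a separate copy in `count₃` keeps the size of that
layer. -/
theorem runs_second {n b : ℕ} {Ls : List (Layer F)} {V : List Value}
    (hO : ∀ N : Network F, encodeNetwork name N ∈ O ↔ N.AllNecessary)
    (hb : constBound hid name ≤ b) (hV : Valid hid n Ls V) (hVb : Between V)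
    (M : Network F) (hM : M.inputs = n)
    (hp : ∀ x : List ℝ, x.length = n → (prevs V).map (fun f => f x) = x)
    (hlen : (lift (M.layers.flatMap (encodeLayer name) ++ [endNetwork])).length + V.length ≤ b)
    (hP : (preWord name n Ls).length ≤ (V.length + 1) * buildTime (sizeBound b)) :
    ∃ s, Runs O (secondProg hid name)
        (conf name n Ls V (lift (M.layers.flatMap (encodeLayer name) ++ [endNetwork]))).store s
        (secondTime b) ∧
      (s .fail = [] ↔ (select Tag.isOutput V).length = M.output.length ∧
        ∀ x : List ℝ, x.length = n →
          (select Tag.isOutput V).map (fun f => f x) = M.eval x) := by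
  have hbB := le_sizeBound b
  obtain ⟨-, h₁, h₂, -, h₄, h₅⟩ := select_readValues n hVb M
  have hpl : (prevs V).length = n := by
    simpa using congrArg List.length (hp (List.replicate n 0) (by simp))
  obtain ⟨Ls', hV', hP', hl, run₁⟩ := runs_readLayers hO (hb.trans hbB) [] M.layers V Ls hV hVb
    (by rw [hpl, ← hM]; exact M.wellFormed) (by rw [List.append_nil]; omega) hP
  rw [List.append_nil] at run₁ hl
  rw [List.length_nil, Nat.zero_add] at hl
  obtain ⟨U, hU⟩ : ∃ U, U = readValues n V M.layers := ⟨_, rfl⟩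
  rw [← hU] at h₁ h₂ h₄ h₅ hV' hP' hl run₁
  obtain ⟨k, hk⟩ : ∃ k, k = (select Tag.isOutput V).length := ⟨_, rfl⟩
  have hkU : ((U.map Prod.fst).filter Tag.isOutput).length = k := by
    rw [length_filter_tags, h₁, hk]
  have hmU : ((U.map Prod.fst).filter Tag.isPrev).length = M.output.length := by
    rw [length_filter_tags, ← h₄]
    rfl
  have hkl : k ≤ U.length := by
    rw [← hkU]
    exact (List.length_filter_le _ _).trans (by simp)
  have hml : M.output.length ≤ U.length := by
    rw [← hmU]
    exact (List.length_filter_le _ _).trans (by simp)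
  have run₂ := Runs.countTags (O := O) Tag.isOutput (k := .count₁) (by simp) (by simp)
    (conf name n Ls' U []) _ rfl rfl
  have run₃ := Runs.countTags (O := O) Tag.isPrev (k := .count₂) (by simp) (by simp)
    { conf name n Ls' U [] with count₁ := marks k } _ rfl rfl
  have run₄ := Runs.countTags (O := O) Tag.isOutput (k := .count₃) (by simp) (by simp)
    { conf name n Ls' U [] with count₁ := marks k, count₂ := marks M.output.length } _ rfl rfl
  have run₅ := Runs.compareCounts (O := O) { conf name n Ls' U [] with
    count₁ := marks k, count₂ := marks M.output.length, count₃ := marks k } k M.output.length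
    rfl rfl rfl
  rw [hkU] at run₂ run₄
  rw [hmU] at run₃
  obtain ⟨s, run₆, hs⟩ := Runs.ifEmpty (O := O) (p := differenceProg hid name)
    (T := differenceTime b) (P := k = M.output.length ∧ ∀ x : List ℝ, x.length = n →
      (select Tag.isOutput V).map (fun f => f x) = M.eval x)
    (S := { conf name n Ls' U [] with
      count₃ := marks k, fail := marks (k - M.output.length + (M.output.length - k)) }) rfl
    (fun h => by
      have hkm : k = M.output.length := by omega
      obtain ⟨s, hs, hs'⟩ := runs_difference hO hb hV' (by omega) (by omega : k ≤ b) hP' h₂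
        hk.symm (h₄.trans hkm.symm)
      refine ⟨s, hs.conv (by rw [h]; rfl) rfl le_rfl, hs'.trans ?_⟩
      rw [and_iff_right hkm]
      refine forall_congr' fun x => imp_congr_right fun hx => ?_
      rw [h₅, hp x hx])
    (fun h h' => by omega)
  rw [← hk]
  refine ⟨s, (run₁.seq (run₂.seq (Runs.seq (run₃.conv ?_ rfl le_rfl) (Runs.seq
    (run₄.conv ?_ rfl le_rfl) (Runs.seq (run₅.conv ?_ rfl le_rfl)
      (run₆.conv rfl rfl le_rfl)))))).mono ?_, hs⟩
  · simp [conf]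
  · simp [conf]
  · simp [conf]
  · have := Nat.mul_le_mul_right (symbolTime (sizeBound b))
      (by omega : (lift (M.layers.flatMap (encodeLayer name) ++ [endNetwork])).length ≤
        sizeBound b)
    simp only [List.length_map, secondTime]
    omega

/-! ### Input values, headers and the complete comparison -/

/-- The values before the first layer. -/
def inputValues (n : ℕ) : List Value := (List.range n).map fun i => (inputTag, fun x => x.getD i 0)

theorem select_inputValues {p : Tag → Bool} (h : p inputTag = true) (n : ℕ) :
    select p (inputValues n) = (List.range n).map fun i x => x.getD i 0 := by
  simp [select, inputValues, List.filter_map, Function.comp_def, h]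

theorem map_getD_range {n : ℕ} {x : List ℝ} (hx : x.length = n) :
    (((List.range n).map fun i (x : List ℝ) => x.getD i 0).map fun f => f x) = x := by
  refine List.ext_getElem (by simp [hx]) fun i h₁ h₂ => ?_
  simp [h₂]

theorem valid_inputValues (hid : id ∈ F) (n : ℕ) : Valid hid n [] (inputValues n) where
  computes := by
    rw [show kept (inputValues n) = _ from select_inputValues (p := Tag.kept) rfl n]
    exact computes_nil hid n
  dropped := by
    intro p hp hk
    obtain ⟨i, _, rfl⟩ := List.mem_map.1 hp
    exact absurd hk (by simp [inputTag])

/-- The number of symbols other than `endWord`. -/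
def size (d : Word) : ℕ := (d.filter fun g => !decide (g = .inl endWord)).length

theorem size_append_singleton (d : Word) (g : Cell) :
    size (d ++ [g]) = if g = .inl endWord then size d else size d + 1 := by
  split_ifs with h <;> simp [size, h]

theorem size_bits (n : ℕ) : size (lift (encodeBits endWord (List.replicate n true))) = n := by
  simp [size, encodeBits, lift]

theorem runs_header (n : ℕ) (r : Word) :
    Runs O (readWord fun g => .push .pre g ;;
        countStep (.push .units mark ;; .push .tags (.inr inputTag)) g)
      ({ input := lift (encodeBits endWord (List.replicate n true)) ++ r } : Stacks).store
      (conf (F := F) name n [] (inputValues n) r).store ((n + 1) * 4) := by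
  obtain ⟨w, hw, hw'⟩ := isWord_bits (List.replicate n true)
  have hn := size_bits n
  have hl := congrArg List.length hw
  refine (Runs.readWord (w := w) (r := r) (T := 3) (fun d r => Stacks.store
    { input := r, pre := d.reverse, tags := List.replicate (size d) (.inr inputTag)
      units := marks (size d) }) (fun d r => rfl) hw' (fun d g v => ?_)).conv ?_ ?_ ?_
  · rw [size_append_singleton]
    unfold countStep
    split_ifs with hg
    · exact ((Runs.push _ _).seq Runs.skip).congr (by simp) (by omega)
    · exact ((Runs.push _ _).seq ((Runs.push _ _).seq (Runs.push _ _))).congr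
        (by simp [marks_succ, List.replicate_succ]) (by omega)
  · rw [hw]
    simp [size, marks]
  · rw [← hw, hn]
    have : (kept (inputValues n)).length = n := by
      rw [show kept (inputValues n) = _ from select_inputValues (p := Tag.kept) rfl n]
      simp
    rw [conf, this]
    simp [preWord, tagWord, inputValues, Function.comp_def]
  · have : w.length = n := by simpa [encodeBits] using hl.symm
    rw [this]

theorem runs_secondHeader (S : Stacks) (n : ℕ) (r : Word) (h : S.count₁ = [])
    (h' : S.input = lift (encodeBits endWord (List.replicate n true)) ++ r) :
    Runs O (readWord (countStep (.push .count₁ mark))) S.store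
      { S with input := r, count₁ := marks n }.store ((n + 1) * 2) := by
  obtain ⟨w, hw, hw'⟩ := isWord_bits (List.replicate n true)
  have hn := size_bits n
  have hl := congrArg List.length hw
  refine (Runs.readWord (w := w) (r := r) (T := 1) (fun d r => Stacks.store
    { S with input := r, count₁ := marks (size d) }) (fun d r => rfl) hw'
    (fun d g v => ?_)).conv ?_ ?_ ?_
  · rw [size_append_singleton]
    unfold countStep
    split_ifs with hg
    · exact Runs.skip.congr (by simp) (by omega)
    · exact (Runs.push _ _).congr (by simp [marks_succ]) (by omega)
  · rw [hw] at h'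
    cases S
    simp_all [size, marks]
  · rw [← hw, hn]
  · have : w.length = n := by simpa [encodeBits] using hl.symm
    rw [this]

/-- A time bound for `equivalenceProg`. -/
def equivalenceTime (b : ℕ) : ℕ :=
  sizeBound b * symbolTime (sizeBound b) + secondTime b + 30 * b + 50

/-- The invariant after the first network is still valid when the second one is read: retagging
makes the inputs the previous layer again and marks the outputs of the first network, but leaves the
computed functions and the built layers untouched. -/
theorem runs_equivalence {b : ℕ} (hO : ∀ N : Network F, encodeNetwork name N ∈ O ↔ N.AllNecessary)
    (N M : Network F) (hb : constBound hid name ≤ b)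
    (hlen : (encodeNetwork name N ++ encodeNetwork name M).length ≤ b) :
    ∃ s, Runs O (equivalenceProg hid name)
        (inputStore (encodeNetwork name N ++ encodeNetwork name M)) s (equivalenceTime b) ∧
      (s .fail = [] ↔ SameFunction N M) := by
  obtain ⟨n, hn⟩ : ∃ n, n = N.inputs := ⟨_, rfl⟩
  obtain ⟨m, hm⟩ : ∃ m, m = M.inputs := ⟨_, rfl⟩
  obtain ⟨V₀, hV₀⟩ : ∃ V, V = inputValues n := ⟨_, rfl⟩
  obtain ⟨V₁, hV₁⟩ : ∃ V, V = readValues n V₀ N.layers := ⟨_, rfl⟩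
  obtain ⟨V₂, hV₂⟩ : ∃ V, V = retag Tag.startSecond V₁ := ⟨_, rfl⟩
  obtain ⟨u, hu⟩ : ∃ u, u = lift (M.layers.flatMap (encodeLayer name) ++ [endNetwork]) :=
    ⟨_, rfl⟩
  have hw : (encodeNetwork name N ++ encodeNetwork name M).map Sum.inl =
      lift (encodeBits endWord (List.replicate n true)) ++
        (lift (N.layers.flatMap (encodeLayer name) ++ [endNetwork]) ++
          (lift (encodeBits endWord (List.replicate m true)) ++ u)) := by
    simp [encodeNetwork, hn, hm, hu, lift]
  have hwl := congrArg List.length hw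
  rw [List.length_map] at hwl
  rw [hwl] at hlen
  have hbits : ∀ k, (lift (encodeBits endWord (List.replicate k true))).length = k + 1 := by
    simp [encodeBits]
  have hV₀l : V₀.length = n := by simp [hV₀, inputValues]
  have hV₀i : ∀ p : Tag → Bool, p inputTag = true →
      select p V₀ = (List.range n).map fun i x => x.getD i 0 :=
    fun p hp => hV₀ ▸ select_inputValues hp n
  have hV₀b : Between V₀ := by
    intro p hp
    rw [hV₀] at hp
    obtain ⟨i, _, rfl⟩ := List.mem_map.1 hp
    simp [inputTag]
  simp only [List.length_append, hbits] at hlen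
  have hbB := le_sizeBound b
  have hpre : (preWord (F := F) name n []).length ≤ (V₀.length + 1) * buildTime (sizeBound b) := by
    have : 1 ≤ buildTime (sizeBound b) := by
      rw [buildTime]
      omega
    have := Nat.mul_le_mul_left (V₀.length + 1) this
    simp [preWord, encodeBits, hV₀l] at this ⊢
    omega
  have run₁ := runs_header (O := O) (name := name) n
    (lift (N.layers.flatMap (encodeLayer name) ++ [endNetwork]) ++
      (lift (encodeBits endWord (List.replicate m true)) ++ u))
  rw [← hV₀] at run₁
  obtain ⟨Ls, hv, hP, hl, run₂⟩ := runs_readLayers hO (hb.trans hbB)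
    (lift (encodeBits endWord (List.replicate m true)) ++ u) N.layers V₀ []
    (hV₀ ▸ valid_inputValues hid n) hV₀b
    (by
      rw [show prevs V₀ = _ from hV₀i Tag.isPrev rfl]
      rw [List.length_map, List.length_range, hn]
      exact N.wellFormed)
    (by simp only [List.length_append, hbits]; omega) hpre
  obtain ⟨hin, -, -, -, hlout, hout⟩ := select_readValues n hV₀b N
  rw [← hV₁] at hv hP hl run₂ hin hlout hout
  have run₃ := runs_relabel (O := O) (name := name) (n := n) (f := Tag.startSecond)
    (fun _ => rfl) Ls V₁ (lift (encodeBits endWord (List.replicate m true)) ++ u)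
  rw [← hV₂] at run₃
  have hV₂l : V₂.length = V₁.length := by rw [hV₂, length_retag]
  have run₄ := runs_secondHeader (O := O)
    (conf name n Ls V₂ (lift (encodeBits endWord (List.replicate m true)) ++ u)) m u rfl rfl
  have run₅ := Runs.countTags (O := O) Tag.isInput (k := .count₂) (by simp) (by simp)
    { conf name n Ls V₂ u with count₁ := marks m } _ rfl rfl
  have hsel : select Tag.isInput V₂ = (List.range n).map fun i x => x.getD i 0 := by
    rw [hV₂, select_retag, ← hV₀i Tag.isInput rfl, ← hin]
    rfl
  rw [length_filter_tags, hsel, List.length_map, List.length_range] at run₅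
  have run₆ := Runs.compareCounts (O := O) { conf name n Ls V₂ u with
    count₁ := marks m, count₂ := marks n } m n rfl rfl rfl
  -- The tag `isInput` is never changed by reading layers, so the values restored as previous are
  -- the coordinate functions in their original order.
  have hV₂p : prevs V₂ = (List.range n).map fun i x => x.getD i 0 := by
    rw [← hsel, hV₂]
    refine (select_retag Tag.isPrev _ V₁).trans
      (Eq.trans (select_congr fun v _ => ?_) (select_retag Tag.isInput _ V₁).symm)
    simp only [Tag.isPrev, Tag.startSecond]
    split_ifs with h <;> simp_all
  have hV₂o : select Tag.isOutput V₂ = prevs V₁ := by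
    rw [hV₂, select_retag]
    rfl
  obtain ⟨s, run₇, hs⟩ := Runs.ifEmpty (O := O) (p := secondProg hid name) (T := secondTime b)
    (P := SameFunction N M) (S := { conf name n Ls V₂ u with fail := marks (m - n + (n - m)) })
    rfl
    (fun h => by
      have hmn : m = n := by omega
      obtain ⟨s, hs, hs'⟩ := runs_second (n := n) (b := b) (Ls := Ls) (V := V₂) hO hb
        (hV₂ ▸ hv.retag fun _ => rfl)
        (hV₂ ▸ between_retag (fun t => by unfold Tag.startSecond; split_ifs <;> simp) V₁)
        M (hm ▸ hmn) (fun x hx => by rw [hV₂p, map_getD_range hx])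
        (by rw [← hu]; simp only [List.length_append, hbits] at hl; omega) (by rwa [hV₂l])
      refine ⟨s, hs.conv (by rw [h, hu]; rfl) rfl le_rfl, hs'.trans ?_⟩
      rw [hV₂o, hlout, SameFunction, ← hn, ← hm, and_iff_right hmn.symm]
      refine and_congr_right fun _ => forall_congr' fun x => imp_congr_right fun hx => ?_
      rw [hout, show prevs V₀ = _ from hV₀i Tag.isPrev rfl, map_getD_range hx])
    (fun h h' => h (by have := h'.1; omega))
  refine ⟨s, (Runs.seq (run₁.conv ?_ rfl le_rfl) (run₂.seq (run₃.seq (Runs.seq run₄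
    (Runs.seq run₅ (Runs.seq (run₆.conv ?_ rfl le_rfl)
      (run₇.conv rfl rfl le_rfl))))))).mono ?_, hs⟩
  · rw [inputStore_eq, hw]
  · simp [conf]
  · simp only [List.length_append, hbits] at hl hlen
    have := Nat.mul_le_mul_right (symbolTime (sizeBound b))
      (by omega : (lift (N.layers.flatMap (encodeLayer name) ++ [endNetwork])).length ≤
        sizeBound b)
    simp only [List.length_map, equivalenceTime]
    omega

/-! ### Polynomial time bounds -/

/-- `f` is a polynomial with natural coefficients. -/
def IsPoly (f : ℕ → ℕ) : Prop := ∃ p : Polynomial ℕ, ∀ s, p.eval s = f s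

theorem IsPoly.const (c : ℕ) : IsPoly fun _ => c := ⟨.C c, by simp⟩

theorem IsPoly.self : IsPoly fun s => s := ⟨.X, by simp⟩

theorem IsPoly.add {f g : ℕ → ℕ} (hf : IsPoly f) (hg : IsPoly g) : IsPoly fun s => f s + g s := by
  obtain ⟨p, hp⟩ := hf
  obtain ⟨q, hq⟩ := hg
  exact ⟨p + q, by simp [hp, hq]⟩

theorem IsPoly.mul {f g : ℕ → ℕ} (hf : IsPoly f) (hg : IsPoly g) : IsPoly fun s => f s * g s := by
  obtain ⟨p, hp⟩ := hf
  obtain ⟨q, hq⟩ := hg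
  exact ⟨p * q, by simp [hp, hq]⟩

theorem IsPoly.comp {f g : ℕ → ℕ} (hf : IsPoly f) (hg : IsPoly g) : IsPoly fun s => f (g s) := by
  obtain ⟨p, hp⟩ := hf
  obtain ⟨q, hq⟩ := hg
  exact ⟨p.comp q, by simp [hp, hq]⟩

theorem isPoly_buildTime : IsPoly buildTime := by
  unfold buildTime
  repeat'
    with_reducible first
      | exact .const _
      | exact .self
      | refine .add ?_ ?_
      | refine .mul ?_ ?_

theorem isPoly_symbolTime : IsPoly symbolTime := by
  have h := isPoly_buildTime
  unfold symbolTime nodeTime askTime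
  repeat'
    with_reducible first
      | exact .const _
      | exact .self
      | exact h
      | refine .add ?_ ?_
      | refine .mul ?_ ?_

theorem isPoly_sizeBound : IsPoly sizeBound := by
  unfold sizeBound
  repeat'
    with_reducible first
      | exact .const _
      | exact .self
      | refine .add ?_ ?_
      | refine .mul ?_ ?_

theorem isPoly_equivalenceTime : IsPoly equivalenceTime := by
  have h₁ := isPoly_symbolTime.comp isPoly_sizeBound
  have h₂ := isPoly_sizeBound
  unfold equivalenceTime secondTime differenceTime
  repeat'
    with_reducible first
      | exact .const _
      | exact .self
      | exact h₁
      | exact h₂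
      | refine .add ?_ ?_
      | refine .mul ?_ ?_

end

end NeuralNet

theorem mainTheorem8 (F : Set (ℝ → ℝ)) (name : F ↪ List Bool) (hid : (id : ℝ → ℝ) ∈ F) :
    (NeuralNet.NE F name).PolyTimeReducesTo (NeuralNet.ANECE F name) := by
  -- The constant `constBound hid name` depends only on the name of the identity, not on the
  -- instance. The final `1` pays for the last step, in which the machine inspects `fail` and halts.
  obtain ⟨p, hp⟩ := ((NeuralNet.isPoly_equivalenceTime.comp
    (NeuralNet.IsPoly.self.add (.const (NeuralNet.constBound hid name)))).add (.const 1))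
  refine ⟨(NeuralNet.equivalenceProg hid name).machine, p, fun O hO a => ?_⟩
  obtain ⟨s, ⟨t, ht, h⟩, hs⟩ := NeuralNet.runs_equivalence
    (b := ((NeuralNet.NE F name).code a).length + NeuralNet.constBound hid name) hO a.1 a.2
    (Nat.le_add_left _ _) (Nat.le_add_right _ _)
  exact h.decidesIn (by rw [hp]; exact Nat.succ_le_succ ht) hs
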